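/- Let $\Sigma$ be a finite signed graph with node set $V$, $|V|=n$, and edge set $E$, $|E|=m$. Every edge is a link (two distinct end nodes, sign $+$ or $-$), a negative loop, or a halfedge (one end node, no sign); parallel edges are allowed, positive loops and loose edges are not. Fix an orientation: a sign $\tau(v,e)\in\{\pm1\}$ for every node $v$ incident with an edge $e$, such that $\sigma(e)=-\tau(u,e)\,\tau(v,e)$ for every link $e$ with ends $u,v$ and sign $\sigma(e)$. The incidence matrix $A\in\mathbb{R}^{V\times E}$ has the entry $\tau(v,e)$ if $v$ is an end of a link or halfedge $e$, $2\tau(v,e)$ if $e$ is a negative loop at $v$, and $0$ otherwise. For $F\subseteq E$ consider the subgraph $(V,F)$; connectedness and connected components are taken with respect to its links. A circle is a closed path of at least two links with distinct nodes and distinct edges. A component is a tree if it contains no circle, loop or halfedge; a halfedge-tree if it contains no circle or loop and exactly one halfedge; a loop-tree if it contains no circle or halfedge and exactly one (negative) loop; and a pseudo-tree if it contains no loop or halfedge and exactly one circle, and this circle has an odd number of negative edges. $F$ is a pseudo-forest if every component of $(V,F)$ is of one of these four types; then $\mathrm{pc}(F)$ and $\mathrm{lc}(F)$ denote the numbers of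 pseudo-tree and loop-tree components. A basis of $\Sigma$ is an inclusion-maximal pseudo-forest $F\subseteq E$. A set $S\subseteq E$ is spanning if it contains a basis, and in that case $\mathrm{pc}(S)+\mathrm{lc}(S)$ denotes the minimum of $\mathrm{pc}(F)+\mathrm{lc}(F)$ over all bases $F\subseteq S$. The zonotope of a real matrix $M$ with $k$ columns is $\mathcal{Z}(M)=M[0,1]^k$, and the Ehrhart polynomial of $P\subseteq\mathbb{R}^d$ is the polynomial $\mathrm{ehr}_P$ with $\mathrm{ehr}_P(t)=|tP\cap\mathbb{Z}^d|$ for all positive integers $t$. **Theorem.** Let $\Sigma$ be connected (in particular $V\neq\emptyset$) with $\operatorname{rank}A=n$. Let $T\subseteq E$ be a basis such that $(V,T)$ is connected and such that $T$ contains a halfedge if $\Sigma$ contains a halfedge. Let $\mathbf{T}$ be the $n\times n$ submatrix of the columns of $A$ in $T$ (in any order) and $\mathbf{R}$ the submatrix of the columns in $E\setminus T$. Then the Ehrhart polynomial of the tocyclotope $Z=\mathcal{Z}([\,I \mid -(\mathbf{T}^{-1}\mathbf{R})^{T}\,])\subseteq\mathbb{R}^{m-n}$ is $$\mathrm{ehr}_Z(t)=\begin{cases}\displaystyle\sum_{S}2^{\mathrm{pc}(S)+\mathrm{lc}(S)}\,t^{\,m-|S|}&\text{if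 }\Sigma\text{ contains a halfedge},\\[2mm]\displaystyle\sum_{S}2^{\mathrm{pc}(S)+\mathrm{lc}(S)-1}\,t^{\,m-|S|}&\text{if }\Sigma\text{ contains no halfedge},\end{cases}$$ where $S$ ranges over all spanning subsets of $E$. -/

import Mathlib

/-- The possible edges of a signed graph on the node set `V` that has neither positive loops nor
loose edges (the signed graphs that have an incidence matrix): a link is an unordered pair of
distinct nodes with a sign, a loop is negative, a halfedge has one end and no sign. -/
inductive SignedEdge (V : Type*) where
  | link (ends : Sym2 V) (ne : ¬ ends.IsDiag) (sign : ℤˣ) : SignedEdge V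
  | negLoop (v : V) : SignedEdge V
  | halfedge (v : V) : SignedEdge V

/-- A signed graph with node set `V` and edge set `E`, without positive loops and loose edges;
parallel edges are allowed. -/
structure SignedGraph (V E : Type*) where
  edge : E → SignedEdge V

namespace SignedGraph

variable {V E : Type*}

/-- `e` is a link with the ends `u` and `v` and the sign `s`. -/
def IsLink (G : SignedGraph V E) (e : E) (u v : V) (s : ℤˣ) : Prop :=
  ∃ h, G.edge e = SignedEdge.link s(u, v) h s

/-- `e` is a link that carries the sign `-`. -/
def IsNegLink (G : SignedGraph V E) (e : E) : Prop :=
  ∃ u v, G.IsLink e u v (-1)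

/-- `e` is a (negative) loop at `v`. -/
def IsLoopAt (G : SignedGraph V E) (e : E) (v : V) : Prop :=
  G.edge e = SignedEdge.negLoop v

/-- `e` is a halfedge at `v`. -/
def IsHalfedgeAt (G : SignedGraph V E) (e : E) (v : V) : Prop :=
  G.edge e = SignedEdge.halfedge v

def IsLoop (G : SignedGraph V E) (e : E) : Prop := ∃ v, G.IsLoopAt e v

def IsHalfedge (G : SignedGraph V E) (e : E) : Prop := ∃ v, G.IsHalfedgeAt e v

def HasHalfedge (G : SignedGraph V E) : Prop := ∃ e, G.IsHalfedge e

/-- The node `v` is an end of the edge `e`. -/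
def Incident (G : SignedGraph V E) (v : V) (e : E) : Prop :=
  (∃ u s, G.IsLink e u v s) ∨ G.IsLoopAt e v ∨ G.IsHalfedgeAt e v

/-- An orientation gives a sign `τ v e` to every incidence of a node and an edge, so that
`σ(e) = - τ(u, e) τ(v, e)` for an edge `e` with ends `u` and `v`. The two incidences of a negative
loop have equal signs, so one value describes them. Values at other pairs are irrelevant. -/
def IsOrientation (G : SignedGraph V E) (τ : V → E → ℤˣ) : Prop :=
  ∀ e u v s, G.IsLink e u v s → s = -(τ u e * τ v e)

/-- The incidence matrix of `G` for the orientation `τ`. -/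
def incidenceMatrix [DecidableEq V] (G : SignedGraph V E) (τ : V → E → ℤˣ) : Matrix V E ℝ :=
  fun v e => match G.edge e with
    | SignedEdge.link p _ _ => if v ∈ p then (((τ v e : ℤˣ) : ℤ) : ℝ) else 0
    | SignedEdge.negLoop w => if v = w then 2 * (((τ v e : ℤˣ) : ℤ) : ℝ) else 0
    | SignedEdge.halfedge w => if v = w then (((τ v e : ℤˣ) : ℤ) : ℝ) else 0

/-- The simple graph of adjacency through links in `F`. A path between two nodes of the subgraph
`(V, F)` is a path in this graph, so the two have the same connected components. -/
def linkGraph (G : SignedGraph V E) (F : Finset E) : SimpleGraph V where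
  Adj u v := ∃ e ∈ F, ∃ s, G.IsLink e u v s
  symm := ⟨by
    rintro u v ⟨e, he, s, h, h'⟩
    have hs : s(u, v) = s(v, u) := Sym2.eq_swap
    refine ⟨e, he, s, hs ▸ h, ?_⟩
    rw [h']
    congr 1⟩
  loopless := ⟨by
    rintro u ⟨e, he, s, h, h'⟩
    exact h (by simp)⟩

/-- The subgraph `(V, F)` is connected (and has a node). -/
def ConnectedOn (G : SignedGraph V E) (F : Finset E) : Prop := (G.linkGraph F).Connected

/-- `C` is the edge set of a circle: a closed path `v₀ e₀ v₁ e₁ … v₀` along `k + 2 ≥ 2` links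
with distinct nodes and distinct edges (the addition in `Fin (k + 2)` is cyclic). Loops are treated
separately. -/
def IsCircle (G : SignedGraph V E) (C : Set E) : Prop :=
  ∃ (k : ℕ) (v : Fin (k + 2) → V) (e : Fin (k + 2) → E),
    Function.Injective v ∧ Function.Injective e ∧
    (∀ i, ∃ s, G.IsLink (e i) (v i) (v (i + 1)) s) ∧ C = Set.range e

/-- The edges in `F` of a connected component `c` of the subgraph `(V, F)`. -/
def compEdges (G : SignedGraph V E) (F : Finset E) (c : (G.linkGraph F).ConnectedComponent) :
    Set E :=
  {e | e ∈ F ∧ ∃ v ∈ c.supp, G.Incident v e}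

section Components

variable (G : SignedGraph V E) (F : Finset E) (c : (G.linkGraph F).ConnectedComponent)

/-- The component `c` of `(V, F)` is a signed tree. -/
def IsTreeComp : Prop :=
  (∀ C ⊆ G.compEdges F c, ¬ G.IsCircle C) ∧
  (∀ e ∈ G.compEdges F c, ¬ G.IsLoop e) ∧
  (∀ e ∈ G.compEdges F c, ¬ G.IsHalfedge e)

/-- The component `c` of `(V, F)` is a halfedge-tree. -/
def IsHalfedgeTreeComp : Prop :=
  (∀ C ⊆ G.compEdges F c, ¬ G.IsCircle C) ∧
  (∀ e ∈ G.compEdges F c, ¬ G.IsLoop e) ∧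
  (∃! e, e ∈ G.compEdges F c ∧ G.IsHalfedge e)

/-- The component `c` of `(V, F)` is a loop-tree. -/
def IsLoopTreeComp : Prop :=
  (∀ C ⊆ G.compEdges F c, ¬ G.IsCircle C) ∧
  (∃! e, e ∈ G.compEdges F c ∧ G.IsLoop e) ∧
  (∀ e ∈ G.compEdges F c, ¬ G.IsHalfedge e)

/-- The component `c` of `(V, F)` is a pseudo-tree: it has no loops and no halfedges, and it
contains exactly one circle, which has an odd number of negative edges. -/
def IsPseudoTreeComp : Prop :=
  (∃ C ⊆ G.compEdges F c, G.IsCircle C ∧ Odd {e | e ∈ C ∧ G.IsNegLink e}.ncard ∧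
    ∀ C' ⊆ G.compEdges F c, G.IsCircle C' → C' = C) ∧
  (∀ e ∈ G.compEdges F c, ¬ G.IsLoop e) ∧
  (∀ e ∈ G.compEdges F c, ¬ G.IsHalfedge e)

end Components

/-- The subgraph `(V, F)` is a signed pseudo-forest. -/
def IsPseudoForest (G : SignedGraph V E) (F : Finset E) : Prop :=
  ∀ c, G.IsTreeComp F c ∨ G.IsHalfedgeTreeComp F c ∨ G.IsLoopTreeComp F c ∨ G.IsPseudoTreeComp F c

/-- A basis of `G` is an inclusion-maximal pseudo-forest of `G`. -/
def IsBasis (G : SignedGraph V E) (F : Finset E) : Prop := Maximal G.IsPseudoForest F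

/-- The number of pseudo-tree components of `(V, F)`. -/
noncomputable def pc (G : SignedGraph V E) (F : Finset E) : ℕ :=
  Nat.card {c // G.IsPseudoTreeComp F c}

/-- The number of loop-tree components of `(V, F)`. -/
noncomputable def lc (G : SignedGraph V E) (F : Finset E) : ℕ :=
  Nat.card {c // G.IsLoopTreeComp F c}

/-- `S` is spanning: it contains a maximal pseudo-forest of `G`. -/
def IsSpanning (G : SignedGraph V E) (S : Finset E) : Prop := ∃ F ⊆ S, G.IsBasis F

open Classical in
/-- The finite set of all spanning edge sets. -/
noncomputable def spanningSets [Fintype E] (G : SignedGraph V E) : Finset (Finset E) :=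
  Finset.univ.filter G.IsSpanning

/-- For a spanning set `S`: the smallest number of pseudo-tree components plus loop-tree components
of a maximal pseudo-forest contained in `S`. -/
noncomputable def minPcLc (G : SignedGraph V E) (S : Finset E) : ℕ :=
  sInf {k | ∃ F ⊆ S, G.IsBasis F ∧ k = G.pc F + G.lc F}

section Tocyclotope

variable [Fintype V] [DecidableEq V] (A : Matrix V E ℝ) (T : Finset E) (φ : V ≃ {e // e ∈ T})

/-- The square submatrix of the columns of `A` in `T`, put in an order by `φ`. -/
def basisMatrix : Matrix V V ℝ := A.submatrix id (fun v => (φ v : E))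

/-- The submatrix of the columns of `A` outside `T`. -/
def restMatrix : Matrix V {e // e ∉ T} ℝ := A.submatrix id Subtype.val

/-- The binet matrix `B = T⁻¹ R`. -/
noncomputable def binetMatrix : Matrix V {e // e ∉ T} ℝ :=
  (basisMatrix A T φ)⁻¹ * restMatrix A T

/-- The matrix `[I | -Bᵀ]` with `m - n` rows and `m` columns. -/
noncomputable def dualMatrix [DecidableEq E] :
    Matrix {e // e ∉ T} ({e // e ∉ T} ⊕ V) ℝ :=
  Matrix.fromCols 1 (-(binetMatrix A T φ).transpose)

end Tocyclotope

end SignedGraph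

/-- The zonotope `A [0,1]^m` generated by the columns of `A`. -/
def zonotope {ι κ : Type*} [Fintype κ] (A : Matrix ι κ ℝ) : Set (ι → ℝ) :=
  (fun x => A.mulVec x) '' Set.Icc 0 1

/-- The lattice points of the dilate `t P`. -/
def dilateLatticePoints {ι : Type*} (P : Set (ι → ℝ)) (t : ℕ) : Set (ι → ℝ) :=
  {x | (∃ y ∈ P, x = (t : ℝ) • y) ∧ ∀ i, ∃ z : ℤ, x i = z}

/-- `p` is the Ehrhart polynomial of `P`: for every positive integer `t`, the dilate `t P` has
exactly `p(t)` lattice points. -/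
def IsEhrhartPolynomial {ι : Type*} (P : Set (ι → ℝ)) (p : Polynomial ℚ) : Prop :=
  ∀ t : ℕ, 0 < t → (dilateLatticePoints P t).Finite ∧
    ((dilateLatticePoints P t).ncard : ℚ) = p.eval (t : ℚ)

/-! For an abelian group X let K_X(F) (`edgeKer X`) be the group of labellings V → X that are
orthogonal to the columns of A in F. Real labellings detect rank: K_ℝ(F) = 0 means that the columns
in F span ℝ^V. Labellings in ℝ/ℤ detect the arithmetic: for spanning F the group K_{ℝ/ℤ}(F) is
finite and replaces all determinants.

Geometry. The matrix [I | -Bᵀ], with B = T⁻¹R, is a linear map on ℝ^E whose kernel is the row space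
U of A. If B is integral, it maps ℤ^E onto the lattice of the target, so the lattice points of tZ
are the classes modulo U of integer points in U + [0,t]^E. A deletion-contraction argument counts
them (`ncard_zonotopeClasses`): the count is the sum of index(I) t^|I| over the sets I of unit
vectors that are independent modulo U. Such I are the complements of the spanning sets S, and
index(I) = [K_{ℝ/ℤ}(S) : K_{ℝ/ℤ}(E)] (`latticeIndex_rowSpace`).

Graphs. Pseudo-forests are exactly the independent sets of columns (`isPseudoForest_iff_isIndep`).
Every component of a basis has a halfedge, a loop or an odd circle, each of which forces 2y = 0 on
the component. So over a spanning S a labelling in ℝ/ℤ is constant on components with values in {0,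
1/2}, and zero on components with a halfedge. For a basis F this gives |K_{ℝ/ℤ}(F)| =
2^(pc(F)+lc(F)). If F ⊆ S then K(S) ≤ K(F), and some basis attains equality, so the exponent for S
is the minimum (`card_edgeKer_eq_two_pow_minPcLc`). As Σ is connected, |K_{ℝ/ℤ}(E)| is 1 or 2,
according to whether there is a halfedge. The conditions on T give K_{ℝ/ℤ}(T) = K_{ℝ/ℤ}(E), which
makes B integral. -/

/-! ### Counting lattice points of zonotopes modulo a subspace -/

section LatticePoints

/-- A bounded nonempty interval gains exactly `n` integers when it is extended by `[0, n]`. -/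
theorem Set.OrdConnected.ncard_int_add_Icc_diff {I : Set ℝ} (hI : I.OrdConnected)
    (hne : I.Nonempty) (hb : BddAbove I) (n : ℕ) :
    {z : ℤ | (∃ i ∈ I, i ≤ z ∧ (z : ℝ) ≤ i + n) ∧ (z : ℝ) ∉ I}.ncard = n := by
  obtain ⟨i₀, hi₀⟩ := hne
  obtain ⟨b, hb⟩ := hb
  -- `k` is the least integer strictly above `I`; the integers gained are k, …, k + n - 1.
  obtain ⟨k, hk, hmin⟩ := Int.exists_least_of_bdd (P := fun z : ℤ => ∀ i ∈ I, i < z)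
    ⟨⌊i₀⌋, fun z hz => by
      have := hz i₀ hi₀
      exact Int.floor_le_iff.2 (by linarith)⟩
    ⟨⌊b⌋ + 1, fun i hi => by
      have := Int.lt_floor_add_one b
      push_cast
      linarith [hb hi]⟩
  have hset : {z : ℤ | (∃ i ∈ I, i ≤ z ∧ (z : ℝ) ≤ i + n) ∧ (z : ℝ) ∉ I}
      = ↑(Finset.Ico k (k + n)) := by
    ext z
    simp only [Set.mem_ofPred_eq, Finset.coe_Ico, Set.mem_Ico]
    constructor
    · rintro ⟨⟨i, hi, h1, h2⟩, hz⟩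
      refine ⟨hmin z fun j hj => ?_, ?_⟩
      · by_contra! h
        exact hz (hI.out hi hj ⟨h1, h⟩)
      · by_contra! h
        have := hk i hi
        have h' : (k : ℝ) + n ≤ z := by exact_mod_cast h
        linarith
    · rintro ⟨h1, h2⟩
      have h1' : (k : ℝ) ≤ z := by exact_mod_cast h1
      have hzI : ∀ i ∈ I, i < (z : ℝ) := fun i hi => (hk i hi).trans_le h1'
      refine ⟨?_, fun h => lt_irrefl _ (hzI _ h)⟩
      have : ¬ ∀ i ∈ I, i < ((z - n : ℤ) : ℝ) := fun h => by
        have := hmin _ h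
        omega
      push Not at this
      obtain ⟨i, hi, hle⟩ := this
      refine ⟨i, hi, (hzI i hi).le, ?_⟩
      push_cast at hle
      linarith
  rw [hset, Set.ncard_coe_finset]
  simp

theorem Set.Finite.ncard_eq_mul_of_fibers {α β : Type*} {A : Set α} {B : Set β} (f : α → β)
    (hB : B.Finite) (hf : ∀ x ∈ A, f x ∈ B) {n : ℕ} (hn : 0 < n)
    (h : ∀ b ∈ B, {x ∈ A | f x = b}.ncard = n) : A.Finite ∧ A.ncard = n * B.ncard := by
  classical
  have hfin : A.Finite := by
    have : A = ⋃ b ∈ B, {x ∈ A | f x = b} := by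
      ext x
      simp only [Set.mem_iUnion, Set.mem_ofPred_eq, exists_prop]
      exact ⟨fun hx => ⟨f x, hf x hx, hx, rfl⟩, fun ⟨_, _, hx, _⟩ => hx⟩
    rw [this]
    exact hB.biUnion fun b hb => Set.finite_of_ncard_pos (by rw [h b hb]; exact hn)
  refine ⟨hfin, ?_⟩
  lift A to Finset α using hfin
  lift B to Finset β using hB
  rw [Set.ncard_coe_finset, Set.ncard_coe_finset,
    Finset.card_eq_sum_card_fiberwise (f := f) (t := B) (fun x hx => hf x hx)]
  rw [Finset.sum_congr rfl (g := fun _ => n), Finset.sum_const, smul_eq_mul, mul_comm]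
  intro b hb
  rw [← h b hb, ← Set.ncard_coe_finset]
  congr 1
  ext x
  simp

theorem AddSubgroup.relIndex_zmultiples_one_inv {g : ℕ} (hg : g ≠ 0) :
    (AddSubgroup.zmultiples (1 : ℝ)).relIndex (AddSubgroup.zmultiples (1 / g : ℝ)) = g := by
  have hg' : (g : ℝ) ≠ 0 := by exact_mod_cast hg
  have hr : (zmultiplesHom ℝ (1 / g : ℝ)).range = AddSubgroup.zmultiples (1 / g : ℝ) := by
    ext x; simp [AddSubgroup.mem_zmultiples_iff]
  rw [← hr, ← AddSubgroup.index_comap]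
  have : (AddSubgroup.zmultiples (1 : ℝ)).comap (zmultiplesHom ℝ (1 / g : ℝ))
      = AddSubgroup.zmultiples (g : ℤ) := by
    ext z
    simp only [AddSubgroup.mem_comap, zmultiplesHom_apply, AddSubgroup.mem_zmultiples_iff,
      zsmul_eq_mul, mul_one]
    constructor
    · rintro ⟨k, hk⟩
      refine ⟨k, ?_⟩
      field_simp at hk
      exact_mod_cast hk
    · rintro ⟨k, rfl⟩
      exact ⟨k, by push_cast; field_simp⟩
  rw [this, Int.index_zmultiples, Int.natAbs_natCast]

/-- By the modular law (A ⊔ K₀) ⊓ K = K₀; the second isomorphism theorem does the rest. -/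
theorem AddSubgroup.relIndex_sup_sup_left {M : Type*} [AddCommGroup M] {A K₀ K : AddSubgroup M}
    (hle : K₀ ≤ K) (h : A ⊓ K ≤ K₀) : (A ⊔ K₀).relIndex (A ⊔ K) = K₀.relIndex K := by
  have h1 : A ⊔ K = K ⊔ (A ⊔ K₀) := by
    rw [sup_comm A K₀, ← sup_assoc, sup_eq_left.2 hle, sup_comm]
  have h2 : (A ⊔ K₀) ⊓ K = K₀ := by
    refine le_antisymm ?_ (le_inf le_sup_right hle)
    rw [sup_comm, sup_inf_assoc_of_le A hle]
    exact sup_le le_rfl h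
  rw [h1, AddSubgroup.relIndex_sup_right, ← AddSubgroup.inf_relIndex_right, h2]

variable {ι W : Type*} [AddCommGroup W] [Module ℝ W]

/-- The classes modulo `U` of the points of the group `L` that lie in `U` plus the `t`-fold dilate
of the zonotope of the vectors `a i`, `i ∈ J`. -/
def zonotopeClasses (L : AddSubgroup W) (U : Submodule ℝ W) (a : ι → W) (J : Finset ι) (t : ℕ) :
    Set (W ⧸ U) :=
  {q | (∃ y ∈ L, U.mkQ y = q) ∧
    ∃ x : ι → ℝ, (∀ i ∈ J, 0 ≤ x i ∧ x i ≤ t) ∧ U.mkQ (∑ i ∈ J, x i • a i) = q}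

/-- The vectors `a i`, `i ∈ I`, are linearly independent modulo `U`. -/
def IndepMod (U : Submodule ℝ W) (a : ι → W) (I : Finset ι) : Prop :=
  ∀ c : ι → ℝ, ∑ i ∈ I, c i • a i ∈ U → ∀ i ∈ I, c i = 0

/-- The index of the group generated by the `a i`, `i ∈ I`, in the points of `L` of their span,
modulo `U`. -/
noncomputable def latticeIndex (L : AddSubgroup W) (U : Submodule ℝ W) (a : ι → W)
    (I : Finset ι) : ℕ :=
  (AddSubgroup.closure (a '' I) ⊔ (L ⊓ U.toAddSubgroup)).relIndex
    (L ⊓ (U ⊔ Submodule.span ℝ (a '' I)).toAddSubgroup)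

variable {L : AddSubgroup W} {U : Submodule ℝ W} {a : ι → W}

theorem mem_sup_span_iff {v y : W} :
    y ∈ U ⊔ Submodule.span ℝ {v} ↔ ∃ c : ℝ, y - c • v ∈ U := by
  rw [Submodule.mem_sup]
  constructor
  · rintro ⟨u, hu, w, hw, rfl⟩
    obtain ⟨c, rfl⟩ := Submodule.mem_span_singleton.1 hw
    exact ⟨c, by simpa using hu⟩
  · rintro ⟨c, hc⟩
    exact ⟨_, hc, _, Submodule.smul_mem _ c (Submodule.mem_span_singleton_self v), by simp⟩

theorem exists_functional_eq_one {v : W} (hv : v ∉ U) :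
    ∃ f : W →ₗ[ℝ] ℝ, f v = 1 ∧ ∀ u ∈ U, f u = 0 := by
  obtain ⟨f, hf, hU⟩ := Submodule.exists_le_ker_of_notMem hv
  exact ⟨(f v)⁻¹ • f, by simp [hf], fun u hu => by simp [LinearMap.mem_ker.1 (hU hu)]⟩

theorem indepMod_empty : IndepMod U a ∅ := fun _ _ _ h => absurd h (Finset.notMem_empty _)

theorem IndepMod.notMem [DecidableEq ι] {I : Finset ι} (h : IndepMod U a I) {i : ι} (hi : i ∈ I) :
    a i ∉ U := fun hU => by
  have := h (Pi.single i 1) (by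
    rw [Finset.sum_eq_single i (fun j _ hj => by simp [hj]) (fun h => absurd hi h)]
    simpa using hU) i hi
  simp at this

theorem indepMod_insert_iff [DecidableEq ι] {I : Finset ι} {v : ι} (hv : v ∉ I) (ha : a v ∉ U) :
    IndepMod U a (insert v I) ↔ IndepMod (U ⊔ Submodule.span ℝ {a v}) a I := by
  have hne : ∀ i ∈ I, i ≠ v := fun i hi h => hv (h ▸ hi)
  constructor
  · intro h c hc i hi
    obtain ⟨r, hr⟩ := mem_sup_span_iff.1 hc
    have := h (Function.update c v (-r)) (by
      rw [Finset.sum_insert hv, Finset.sum_congr rfl (g := fun i => c i • a i)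
        (fun i hi => by rw [Function.update_of_ne (hne i hi)])]
      simp only [Function.update_self, neg_smul]
      rwa [neg_add_eq_sub]) i (Finset.mem_insert_of_mem hi)
    rwa [Function.update_of_ne (hne i hi)] at this
  · intro h c hc
    rw [Finset.sum_insert hv] at hc
    have hI := h c (mem_sup_span_iff.2 ⟨-c v, by rwa [neg_smul, sub_neg_eq_add, add_comm]⟩)
    intro i hi
    rcases Finset.mem_insert.1 hi with rfl | hi
    · rw [Finset.sum_eq_zero (fun j hj => by rw [hI j hj, zero_smul]), add_zero] at hc
      by_contra hci
      exact ha ((U.smul_mem_iff hci).1 hc)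
    · exact hI i hi

theorem exists_sum_of_mem_span_image {I : Finset ι} {x : W}
    (hx : x ∈ Submodule.span ℝ (a '' I)) : ∃ c : ι → ℝ, ∑ i ∈ I, c i • a i = x := by
  classical
  obtain ⟨c, rfl⟩ := (Submodule.mem_span_image_finset_iff_exists_fun ℝ).1 hx
  refine ⟨fun i => if h : i ∈ I then c ⟨i, h⟩ else 0, ?_⟩
  rw [← Finset.sum_coe_sort]
  exact Finset.sum_congr rfl fun i _ => by simp

theorem closure_image_le_span (I : Finset ι) :
    AddSubgroup.closure (a '' I) ≤ (Submodule.span ℝ (a '' I)).toAddSubgroup := by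
  rw [AddSubgroup.closure_le]
  exact Submodule.subset_span

/-- The index is multiplicative along a chain whose middle group is the group generated by the `a
i`, i ∈ I, together with L ∩ (U + ℝ a v). -/
theorem latticeIndex_insert [DecidableEq ι] (ha : ∀ i, a i ∈ L) {I : Finset ι} {v : ι}
    (hv : v ∉ I) (hI : IndepMod U a (insert v I)) :
    latticeIndex L U a (insert v I) =
      latticeIndex L U a {v} * latticeIndex L (U ⊔ Submodule.span ℝ {a v}) a I := by
  have hclL : ∀ J : Finset ι, AddSubgroup.closure (a '' J) ≤ L := fun J => by
    rw [AddSubgroup.closure_le]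
    rintro _ ⟨i, _, rfl⟩
    exact ha i
  set A := AddSubgroup.closure (a '' I)
  set Z := AddSubgroup.closure {a v}
  set U' := U ⊔ Submodule.span ℝ {a v} with hU'
  have hZU : Z ≤ U'.toAddSubgroup := by
    rw [AddSubgroup.closure_le]
    rintro _ rfl
    exact Submodule.mem_sup_right (Submodule.mem_span_singleton_self _)
  have hZL : Z ≤ L := by simpa [Z] using ha v
  have h1 : AddSubgroup.closure (a '' (insert v I : Finset ι)) = A ⊔ Z := by
    rw [Finset.coe_insert, Set.image_insert_eq, Set.insert_eq, AddSubgroup.closure_union, sup_comm]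
  have h2 : U ⊔ Submodule.span ℝ (a '' (insert v I : Finset ι)) =
      U' ⊔ Submodule.span ℝ (a '' I) := by
    rw [Finset.coe_insert, Set.image_insert_eq, Set.insert_eq, Submodule.span_union, hU', sup_assoc]
  -- By independence the group `A` meets U' only in 0, so it can be dropped from both sides of the
  -- lower index.
  have hmid : (A ⊔ (Z ⊔ (L ⊓ U.toAddSubgroup))).relIndex (A ⊔ (L ⊓ U'.toAddSubgroup)) =
      (Z ⊔ (L ⊓ U.toAddSubgroup)).relIndex (L ⊓ U'.toAddSubgroup) := by
    apply AddSubgroup.relIndex_sup_sup_left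
    · refine sup_le (le_inf hZL hZU) (inf_le_inf_left _ ?_)
      exact fun x hx => Submodule.mem_sup_left hx
    · rintro x ⟨hxA, -, hxU⟩
      have hind := (indepMod_insert_iff hv (hI.notMem (Finset.mem_insert_self v I))).1 hI
      have hx := closure_image_le_span I hxA
      obtain ⟨c, rfl⟩ := exists_sum_of_mem_span_image hx
      have := hind c hxU
      rw [Finset.sum_eq_zero fun i hi => by rw [this i hi, zero_smul]]
      exact zero_mem _
  unfold latticeIndex
  rw [h1, h2, Finset.coe_singleton, Set.image_singleton, ← hmid, sup_assoc]
  rw [AddSubgroup.relIndex_mul_relIndex]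
  · exact sup_le_sup_left (sup_le (le_inf hZL hZU)
      (inf_le_inf_left _ fun x hx => Submodule.mem_sup_left hx)) _
  · refine sup_le (le_inf (hclL I) fun x hx => Submodule.mem_sup_right ?_)
      (inf_le_inf_left _ fun x hx => Submodule.mem_sup_left hx)
    exact closure_image_le_span I hx

/-- The coordinate along `a v` maps L ∩ (U + ℝ a v) onto a subgroup Γ of ℝ that contains ℤ with
finite index g. This forces Γ = (1/g)ℤ, and `w` is a preimage of 1/g. An infinite index has the
value 0, so `hg` stands in for discreteness of `L`. -/
theorem exists_lattice_generator {v : ι} (ha : a v ∈ L) (hv : a v ∉ U)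
    (hg : latticeIndex L U a {v} ≠ 0) :
    ∃ w ∈ L, (latticeIndex L U a {v} : ℝ) • w - a v ∈ U ∧
      ∀ y ∈ L, y ∈ U ⊔ Submodule.span ℝ {a v} → ∃ z : ℤ, y - (z : ℝ) • w ∈ U := by
  obtain ⟨f, hf1, hf0⟩ := exists_functional_eq_one hv
  set g := latticeIndex L U a {v} with hgdef
  have hg' : (g : ℝ) ≠ 0 := by exact_mod_cast hg
  have hsub : ∀ y ∈ U ⊔ Submodule.span ℝ {a v}, y - f y • a v ∈ U := by
    intro y hy
    obtain ⟨c, hc⟩ := mem_sup_span_iff.1 hy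
    have := hf0 _ hc
    rw [map_sub, map_smul, hf1, smul_eq_mul, mul_one, sub_eq_zero] at this
    rwa [this]
  set X := L ⊓ (U ⊔ Submodule.span ℝ {a v}).toAddSubgroup with hX
  set fa : W →+ ℝ := f.toAddMonoidHom with hfa
  set Γ := X.map fa with hΓ
  have hH : (AddSubgroup.closure {a v} ⊔ (L ⊓ U.toAddSubgroup)) ⊓ X =
      (AddSubgroup.zmultiples (1 : ℝ)).comap fa ⊓ X := by
    ext y
    simp only [AddSubgroup.mem_inf, AddSubgroup.mem_comap, and_congr_left_iff]
    rintro ⟨hyL, hyU⟩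
    constructor
    · intro hy
      obtain ⟨p, hp, u, hu, rfl⟩ := AddSubgroup.mem_sup.1 hy
      obtain ⟨k, rfl⟩ := AddSubgroup.mem_closure_singleton.1 hp
      rw [map_add]
      have : fa u = 0 := hf0 u hu.2
      rw [this, add_zero, map_zsmul]
      have : fa (a v) = 1 := hf1
      rw [this]
      exact AddSubgroup.zsmul_mem_zmultiples 1 k
    · intro hy
      obtain ⟨k, hk⟩ := AddSubgroup.mem_zmultiples_iff.1 hy
      have hk' : f y = k := by
        have : f y = k • (1 : ℝ) := hk.symm
        simpa using this
      have hyk := hsub y hyU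
      rw [hk', Int.cast_smul_eq_zsmul] at hyk
      refine AddSubgroup.mem_sup.2 ⟨k • a v, AddSubgroup.mem_closure_singleton.2 ⟨k, rfl⟩,
        y - k • a v, ⟨L.sub_mem hyL (L.zsmul_mem ha k), hyk⟩, by abel⟩
  have hgΓ : (AddSubgroup.zmultiples (1 : ℝ)).relIndex Γ = g := by
    rw [hΓ, ← AddSubgroup.relIndex_comap, ← AddSubgroup.inf_relIndex_right, ← hH,
      AddSubgroup.inf_relIndex_right, hgdef, latticeIndex, Finset.coe_singleton,
      Set.image_singleton]
  have hav : a v ∈ X := ⟨ha, Submodule.mem_sup_right (Submodule.mem_span_singleton_self _)⟩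
  -- The quotient Γ/ℤ has order g, so g annihilates it.
  have hΓle : Γ ≤ AddSubgroup.zmultiples (1 / g : ℝ) := by
    intro γ hγ
    have := AddSubgroup.nsmul_index_mem ((AddSubgroup.zmultiples (1 : ℝ)).addSubgroupOf Γ) ⟨γ, hγ⟩
    rw [show ((AddSubgroup.zmultiples (1 : ℝ)).addSubgroupOf Γ).index = g from hgΓ] at this
    obtain ⟨k, hk⟩ := AddSubgroup.mem_zmultiples_iff.1 (AddSubgroup.mem_addSubgroupOf.1 this)
    rw [AddSubgroup.coe_nsmul] at hk
    refine AddSubgroup.mem_zmultiples_iff.2 ⟨k, ?_⟩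
    simp only [zsmul_eq_mul, nsmul_eq_mul, mul_one] at hk ⊢
    rw [hk]
    field_simp
  have hone : AddSubgroup.zmultiples (1 : ℝ) ≤ Γ := by
    rw [AddSubgroup.zmultiples_le]
    exact ⟨a v, hav, hf1⟩
  have hΓeq : AddSubgroup.zmultiples (1 / g : ℝ) ≤ Γ := by
    rw [← AddSubgroup.relIndex_eq_one]
    have := AddSubgroup.relIndex_mul_relIndex _ _ _ hone hΓle
    rw [hgΓ, AddSubgroup.relIndex_zmultiples_one_inv hg] at this
    exact Nat.eq_of_mul_eq_mul_left (Nat.pos_of_ne_zero hg) (by rw [this, mul_one])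
  obtain ⟨w, ⟨hwL, hwU⟩, hw⟩ := hΓeq (AddSubgroup.mem_zmultiples _)
  have hw' : f w = 1 / g := hw
  refine ⟨w, hwL, ?_, fun y hyL hyU => ?_⟩
  · have := U.smul_mem (g : ℝ) (hsub w hwU)
    rwa [hw', smul_sub, smul_smul, mul_one_div_cancel hg', one_smul] at this
  · obtain ⟨z, hz⟩ := AddSubgroup.mem_zmultiples_iff.1 (hΓle ⟨y, ⟨hyL, hyU⟩, rfl⟩)
    have hz' : f y = z * (1 / g) := by rw [← zsmul_eq_mul]; exact hz.symm
    refine ⟨z, ?_⟩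
    have := U.sub_mem (hsub y hyU) (U.smul_mem (z : ℝ) (hsub w hwU))
    rw [hz', hw', smul_sub, smul_smul] at this
    rwa [sub_sub_sub_cancel_right] at this

theorem zonotopeClasses_insert_of_mem [DecidableEq ι] {J : Finset ι} {v : ι} (hv : v ∉ J)
    (ha : a v ∈ U) (t : ℕ) : zonotopeClasses L U a (insert v J) t = zonotopeClasses L U a J t := by
  ext q
  have key : ∀ x : ι → ℝ, U.mkQ (∑ i ∈ insert v J, x i • a i) = U.mkQ (∑ i ∈ J, x i • a i) := by
    intro x
    rw [Finset.sum_insert hv, map_add, map_smul,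
      show U.mkQ (a v) = 0 from (Submodule.Quotient.mk_eq_zero U).2 ha, smul_zero, zero_add]
  refine and_congr_right fun _ => ⟨?_, ?_⟩
  · rintro ⟨x, hx, rfl⟩
    exact ⟨x, fun i hi => hx i (Finset.mem_insert_of_mem hi), (key x).symm⟩
  · rintro ⟨x, hx, rfl⟩
    have hne : ∀ i ∈ J, i ≠ v := fun i hi h => hv (h ▸ hi)
    refine ⟨Function.update x v 0, fun i hi => ?_, ?_⟩
    · rcases Finset.mem_insert.1 hi with rfl | hi
      · simp
      · rw [Function.update_of_ne (hne i hi)]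
        exact hx i hi
    · rw [key, Finset.sum_congr rfl fun i hi => by rw [Function.update_of_ne (hne i hi)]]

theorem zonotopeClasses_mono {J J' : Finset ι} [DecidableEq ι] (h : J ⊆ J') (t : ℕ) :
    zonotopeClasses L U a J t ⊆ zonotopeClasses L U a J' t := by
  rintro q ⟨hL, x, hx, rfl⟩
  refine ⟨hL, fun i => if i ∈ J then x i else 0, fun i _ => ?_, ?_⟩
  · by_cases hi : i ∈ J
    · simpa [hi] using hx i hi
    · simp [hi]
  · congr 1
    rw [← Finset.sum_subset h fun i _ hi => by simp [hi]]
    exact Finset.sum_congr rfl fun i hi => by simp [hi]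

/-- Adding a vector `a v ∉ U` adds lattice points on the lines parallel to `a v`. -/
theorem ncard_zonotopeClasses_insert [DecidableEq ι] {J : Finset ι} {v : ι} (hv : v ∉ J)
    (hL : a v ∈ L) (ha : a v ∉ U) (hg : latticeIndex L U a {v} ≠ 0) {t : ℕ} (ht : 0 < t)
    (h₁ : (zonotopeClasses L U a J t).Finite)
    (h₂ : (zonotopeClasses L (U ⊔ Submodule.span ℝ {a v}) a J t).Finite) :
    (zonotopeClasses L U a (insert v J) t).Finite ∧
      (zonotopeClasses L U a (insert v J) t).ncard = (zonotopeClasses L U a J t).ncard +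
        t * latticeIndex L U a {v} *
          (zonotopeClasses L (U ⊔ Submodule.span ℝ {a v}) a J t).ncard := by
  obtain ⟨w, hwL, hwv, hgen⟩ := exists_lattice_generator hL ha hg
  obtain ⟨f, hf1, hf0⟩ := exists_functional_eq_one ha
  set g := latticeIndex L U a {v} with hgdef
  set U' := U ⊔ Submodule.span ℝ {a v} with hU'
  have hle : U ≤ U' := le_sup_left
  have hg' : (0 : ℝ) < g := by exact_mod_cast Nat.pos_of_ne_zero hg
  have hwU' : w ∈ U' := by
    refine mem_sup_span_iff.2 ⟨1 / g, ?_⟩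
    have := U.smul_mem (1 / g : ℝ) hwv
    rwa [smul_sub, smul_smul, one_div_mul_cancel hg'.ne', one_smul] at this
  have hfw : 0 < f w := by
    have := hf0 _ hwv
    rw [map_sub, map_smul, hf1, smul_eq_mul, sub_eq_zero] at this
    by_contra! h
    nlinarith
  have hq : ∀ y z, U.mkQ y = U.mkQ z ↔ y - z ∈ U := fun y z => Submodule.Quotient.eq U
  have hq' : ∀ y z, U'.mkQ y = U'.mkQ z ↔ y - z ∈ U' := fun y z => Submodule.Quotient.eq U'
  have hvU' : a v ∈ U' := Submodule.mem_sup_right (Submodule.mem_span_singleton_self _)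
  have hne : ∀ i ∈ J, i ≠ v := fun i hi h => hv (h ▸ hi)
  set N := zonotopeClasses L U a (insert v J) t \ zonotopeClasses L U a J t with hN
  have hsub : zonotopeClasses L U a J t ⊆ zonotopeClasses L U a (insert v J) t :=
    zonotopeClasses_mono (Finset.subset_insert v J) t
  -- The new classes are counted by their images in W/U': each class of the zonotope of `J` there
  -- has exactly t * g new classes above it.
  have hmain := Set.Finite.ncard_eq_mul_of_fibers (A := N) (Submodule.factor hle) h₂
    (n := t * g) ?_ (Nat.mul_pos ht (Nat.pos_of_ne_zero hg)) ?_
  · rw [← Set.sdiff_union_of_subset hsub]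
    refine ⟨hmain.1.union h₁, ?_⟩
    rw [Set.ncard_union_eq Set.disjoint_sdiff_left hmain.1 h₁, hmain.2, add_comm]
  · rintro q ⟨⟨⟨y, hy, rfl⟩, x, hx, hxy⟩, -⟩
    refine ⟨⟨y, hy, rfl⟩, x, fun i hi => hx i (Finset.mem_insert_of_mem hi), ?_⟩
    rw [← hxy, Finset.sum_insert hv]
    refine (hq' _ _).2 ?_
    rw [LinearMap.id_apply, sub_add_cancel_right]
    exact U'.neg_mem (U'.smul_mem _ hvU')
  · rintro _ ⟨⟨y₀, hy₀, rfl⟩, x₀, hx₀, hxy₀⟩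
    -- On the line through `y₀` in direction `w`, the old zonotope cuts out the interval `I`;
    -- lattice classes on this line are the integer parameters.
    set I : Set ℝ := {r | ∃ x : ι → ℝ, (∀ i ∈ J, 0 ≤ x i ∧ x i ≤ t) ∧
      y₀ + r • w - ∑ i ∈ J, x i • a i ∈ U} with hI
    have hIc : I.OrdConnected := by
      refine Convex.ordConnected ?_
      rintro r₁ ⟨x₁, hx₁, h₁⟩ r₂ ⟨x₂, hx₂, h₂⟩ α β hα hβ hαβ
      refine ⟨fun i => α * x₁ i + β * x₂ i, fun i hi => ⟨?_, ?_⟩, ?_⟩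
      · have := (hx₁ i hi).1
        have := (hx₂ i hi).1
        positivity
      · calc α * x₁ i + β * x₂ i ≤ α * t + β * t := by
              gcongr
              exacts [(hx₁ i hi).2, (hx₂ i hi).2]
          _ = t := by rw [← add_mul, hαβ, one_mul]
      · have := U.add_mem (U.smul_mem α h₁) (U.smul_mem β h₂)
        convert! this using 1
        simp only [add_smul, mul_smul, Finset.sum_add_distrib, ← Finset.smul_sum, smul_eq_mul]
        obtain rfl : β = 1 - α := by linarith
        module
    have hIne : I.Nonempty := by
      have := (hq' _ _).1 hxy₀.symm
      obtain ⟨c, hc⟩ := mem_sup_span_iff.1 this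
      -- Modulo U' the point `y₀` differs from the zonotope point by c • a v, and a v ≡ g • w modulo
      -- U.
      refine ⟨-(c * g), x₀, hx₀, ?_⟩
      convert! U.sub_mem hc (U.smul_mem c hwv) using 1
      module
    have hIb : BddAbove I := by
      refine ⟨(∑ i ∈ J, t * |f (a i)| - f y₀) / f w, ?_⟩
      rintro r ⟨x, hx, h⟩
      have hf := hf0 _ h
      simp only [map_sub, map_add, map_smul, map_sum, smul_eq_mul] at hf
      have : ∑ i ∈ J, x i * f (a i) ≤ ∑ i ∈ J, t * |f (a i)| := by
        refine Finset.sum_le_sum fun i hi => ?_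
        calc x i * f (a i) ≤ x i * |f (a i)| :=
              mul_le_mul_of_nonneg_left (le_abs_self _) (hx i hi).1
          _ ≤ t * |f (a i)| := mul_le_mul_of_nonneg_right (hx i hi).2 (abs_nonneg _)
      rw [le_div_iff₀ hfw]
      linarith
    have hmemI : ∀ z : ℤ, (z : ℝ) ∈ I ↔ U.mkQ (y₀ + (z : ℝ) • w) ∈ zonotopeClasses L U a J t := by
      intro z
      constructor
      · rintro ⟨x, hx, h⟩
        refine ⟨⟨_, L.add_mem hy₀ ?_, rfl⟩, x, hx, ((hq _ _).2 h).symm⟩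
        rw [Int.cast_smul_eq_zsmul]
        exact L.zsmul_mem hwL z
      · rintro ⟨-, x, hx, h⟩
        exact ⟨x, hx, (hq _ _).1 h.symm⟩
    -- A coefficient of `a v` in [0, t] is a shift by [0, t * g] along `w`, so the new zonotope cuts
    -- out I + [0, t * g].
    have hmemJ : ∀ z : ℤ, (∃ i ∈ I, i ≤ z ∧ (z : ℝ) ≤ i + (t * g : ℕ)) ↔
        U.mkQ (y₀ + (z : ℝ) • w) ∈ zonotopeClasses L U a (insert v J) t := by
      intro z
      constructor
      · rintro ⟨i, ⟨x, hx, h⟩, hiz, hzi⟩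
        push_cast at hzi
        refine ⟨⟨_, L.add_mem hy₀ ?_, rfl⟩, Function.update x v ((z - i) / g), ?_, ?_⟩
        · rw [Int.cast_smul_eq_zsmul]
          exact L.zsmul_mem hwL z
        · intro j hj
          rcases Finset.mem_insert.1 hj with rfl | hj
          · rw [Function.update_self, div_le_iff₀ hg']
            exact ⟨div_nonneg (by linarith) hg'.le, by linarith⟩
          · rw [Function.update_of_ne (hne j hj)]
            exact hx j hj
        · rw [Finset.sum_insert hv, Finset.sum_congr rfl (g := fun i => x i • a i)
            fun i hi => by rw [Function.update_of_ne (hne i hi)], Function.update_self]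
          refine ((hq _ _).2 ?_).symm
          convert! U.add_mem h (U.smul_mem ((z - i) / g) hwv) using 1
          rw [smul_sub, smul_smul, div_mul_cancel₀ _ hg'.ne']
          module
      · rintro ⟨-, x, hx, h⟩
        have hxv := hx v (Finset.mem_insert_self v J)
        refine ⟨z - g * x v, ⟨x, fun i hi => hx i (Finset.mem_insert_of_mem hi), ?_⟩, ?_, ?_⟩
        · have h := (hq _ _).1 h.symm
          rw [Finset.sum_insert hv] at h
          convert! U.sub_mem h (U.smul_mem (x v) hwv) using 1
          module
        · have := mul_nonneg hg'.le hxv.1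
          linarith
        · have := mul_le_mul_of_nonneg_left hxv.2 hg'.le
          push_cast
          linarith
    have himg : {q ∈ N | Submodule.factor hle q = U'.mkQ y₀} =
        (fun z : ℤ => U.mkQ (y₀ + (z : ℝ) • w)) ''
          {z : ℤ | (∃ i ∈ I, i ≤ z ∧ (z : ℝ) ≤ i + (t * g : ℕ)) ∧ (z : ℝ) ∉ I} := by
      ext q
      constructor
      · rintro ⟨hqN, hqf⟩
        obtain ⟨y, hy, rfl⟩ := hqN.1.1
        obtain ⟨z, hz⟩ := hgen (y - y₀) (L.sub_mem hy hy₀) ((hq' _ _).1 hqf)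
        have hyz : U.mkQ y = U.mkQ (y₀ + (z : ℝ) • w) := (hq _ _).2 (by rwa [← sub_sub])
        rw [hyz] at hqN ⊢
        exact ⟨z, ⟨(hmemJ z).2 hqN.1, fun h => hqN.2 ((hmemI z).1 h)⟩, rfl⟩
      · rintro ⟨z, ⟨hz1, hz2⟩, rfl⟩
        refine ⟨⟨(hmemJ z).1 hz1, fun h => hz2 ((hmemI z).2 h)⟩, (hq' _ _).2 ?_⟩
        rw [LinearMap.id_apply, add_sub_cancel_left]
        exact U'.smul_mem _ hwU'
    rw [himg, Set.ncard_image_of_injective, hIc.ncard_int_add_Icc_diff hIne hIb]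
    intro z z' hz
    have := hf0 _ ((hq _ _).1 hz)
    rw [add_sub_add_left_eq_sub, ← sub_smul, map_smul, smul_eq_mul] at this
    rcases mul_eq_zero.1 this with h | h
    · exact_mod_cast sub_eq_zero.1 h
    · exact absurd h hfw.ne'

/-- Induction on `J`. The sets I that avoid v count the classes modulo U for the smaller family
(deletion), the sets that contain v count those modulo U + ℝ a v (contraction), and
`latticeIndex_insert` matches the weights. -/
theorem ncard_zonotopeClasses [DecidableEq ι] (ha : ∀ i, a i ∈ L) {t : ℕ} (ht : 0 < t)
    (J : Finset ι) (U : Submodule ℝ W)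
    (hJ : ∀ I ⊆ J, IndepMod U a I → latticeIndex L U a I ≠ 0) :
    (zonotopeClasses L U a J t).Finite ∧
      (zonotopeClasses L U a J t).ncard =
        ∑ I ∈ J.powerset, open Classical in
          if IndepMod U a I then latticeIndex L U a I * t ^ I.card else 0 := by
  classical
  induction J using Finset.induction_on generalizing U with
  | empty =>
    have h0 : zonotopeClasses L U a ∅ t = {0} := by
      ext q
      constructor
      · rintro ⟨-, x, -, rfl⟩
        simp
      · rintro rfl
        exact ⟨⟨0, L.zero_mem, map_zero _⟩, 0, by simp, by simp⟩
    rw [h0]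
    simp [indepMod_empty, latticeIndex, AddSubgroup.relIndex_self]
  | insert v J hv ih =>
    rw [Finset.sum_powerset_insert hv]
    have h₁ := ih U fun I hI => hJ I (hI.trans (Finset.subset_insert v J))
    have hvI : ∀ I ∈ J.powerset, v ∉ I := fun I hI h => hv (Finset.mem_powerset.1 hI h)
    by_cases hU : a v ∈ U
    · rw [zonotopeClasses_insert_of_mem hv hU]
      refine ⟨h₁.1, ?_⟩
      rw [h₁.2, Finset.sum_eq_zero (s := J.powerset)
        (f := fun I => if IndepMod U a (insert v I) then _ else 0), add_zero]
      intro I _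
      rw [if_neg fun h => h.notMem (Finset.mem_insert_self v I) hU]
    · have hind : ∀ I ⊆ J, IndepMod (U ⊔ Submodule.span ℝ {a v}) a I →
          IndepMod U a (insert v I) := fun I hI =>
        (indepMod_insert_iff (fun h => hv (hI h)) hU).2
      have hne : ∀ I ⊆ J, IndepMod (U ⊔ Submodule.span ℝ {a v}) a I →
          latticeIndex L U a {v} ≠ 0 ∧ latticeIndex L (U ⊔ Submodule.span ℝ {a v}) a I ≠ 0 := by
        intro I hI h
        rw [← mul_ne_zero_iff, ← latticeIndex_insert ha (fun h => hv (hI h)) (hind I hI h)]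
        exact hJ _ (Finset.insert_subset_insert v hI) (hind I hI h)
      have h₂ := ih (U ⊔ Submodule.span ℝ {a v}) fun I hI h => (hne I hI h).2
      obtain ⟨hfin, hcard⟩ := ncard_zonotopeClasses_insert hv (ha v) hU
        (hne ∅ (Finset.empty_subset J) indepMod_empty).1 ht h₁.1 h₂.1
      refine ⟨hfin, ?_⟩
      rw [hcard, h₁.2, h₂.2, Finset.mul_sum]
      congr 1
      refine Finset.sum_congr rfl fun I hI => ?_
      have hvI := hvI I hI
      simp only [indepMod_insert_iff hvI hU, mul_ite, mul_zero]
      split_ifs with h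
      · rw [latticeIndex_insert ha hvI ((indepMod_insert_iff hvI hU).2 h),
          Finset.card_insert_of_notMem hvI, pow_succ]
        ring
      · rfl

end LatticePoints

namespace SignedGraph

/-! ### Cyclic walks and the kinds of edges -/

section Cycles

open scoped Fin.NatCast Fin.CommRing

variable {k : ℕ}

/-- Starting at `j + 1`, the walk reaches every index before it needs the step out of `j`. Hence the
property passes around a circle even if one of its edges is missing. -/
theorem fin_cycle_induction {P : Fin (k + 2) → Prop} (j : Fin (k + 2)) (h₀ : P (j + 1))
    (h : ∀ i, i ≠ j → P i → P (i + 1)) (i : Fin (k + 2)) : P i := by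
  have key : ∀ t : ℕ, t ≤ k + 1 → P (j + 1 + (t : Fin (k + 2))) := by
    intro t
    induction t with
    | zero => intro _; simpa using h₀
    | succ t ih =>
      intro ht
      have := h (j + 1 + (t : Fin (k + 2))) ?_ (ih (by omega))
      · rwa [add_assoc, ← Nat.cast_succ] at this
      · intro hj
        rw [add_assoc, add_eq_left, add_comm (1 : Fin (k + 2)), ← Nat.cast_succ, Fin.natCast_eq_zero] at hj
        exact absurd (Nat.le_of_dvd (Nat.succ_pos t) hj) (by omega)
  have := key (i - (j + 1)).val (by omega)
  rwa [Fin.cast_val_eq_self, add_sub_cancel] at this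

/-- The walk from `j + 1` to `j` collects all signs but `s j`; the last factor completes the
product. -/
theorem cyclic_smul {X : Type*} [AddCommGroup X] (x : Fin (k + 2) → X) (s : Fin (k + 2) → ℤˣ)
    (j : Fin (k + 2)) (h : ∀ i, i ≠ j → x (i + 1) = s i • x i) :
    s j • x j = (∏ i, s i) • x (j + 1) := by
  have key : ∀ t : ℕ, t ≤ k + 1 → x (j + 1 + (t : Fin (k + 2))) =
      (∏ l ∈ Finset.range t, s (j + 1 + (l : Fin (k + 2)))) • x (j + 1) := by
    intro t
    induction t with
    | zero => intro _; simp
    | succ t ih =>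
      intro ht
      rw [Nat.cast_succ, ← add_assoc, h, ih (by omega), Finset.prod_range_succ, mul_comm, mul_smul]
      intro hj
      rw [add_assoc, add_eq_left, add_comm (1 : Fin (k + 2)), ← Nat.cast_succ, Fin.natCast_eq_zero] at hj
      exact absurd (Nat.le_of_dvd (Nat.succ_pos t) hj) (by omega)
  have hj : j + 1 + ((k + 1 : ℕ) : Fin (k + 2)) = j := by
    rw [add_assoc, add_eq_left, add_comm (1 : Fin (k + 2)), ← Nat.cast_succ]
    exact Fin.natCast_self _
  have hprod : ∏ i, s i = ∏ l ∈ Finset.range (k + 2), s (j + 1 + (l : Fin (k + 2))) := by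
    rw [← Equiv.prod_comp (Equiv.addLeft (j + 1)), Finset.prod_range]
    simp [add_assoc]
  have := key (k + 1) le_rfl
  rw [hj] at this
  rw [hprod, Finset.prod_range_succ, hj, mul_comm, mul_smul, ← this]

end Cycles

variable {V E : Type*} {G : SignedGraph V E}

section Edges

theorem IsLink.symm {e : E} {u v : V} {s : ℤˣ} (h : G.IsLink e u v s) : G.IsLink e v u s := by
  obtain ⟨h, h'⟩ := h
  have hs : s(u, v) = s(v, u) := Sym2.eq_swap
  refine ⟨hs ▸ h, ?_⟩
  rw [h']
  congr 1

theorem IsLink.ne {e : E} {u v : V} {s : ℤˣ} (h : G.IsLink e u v s) : u ≠ v := by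
  rintro rfl
  exact h.1 (by simp)

theorem IsLink.eq_and_eq {e : E} {u v u' v' : V} {s s' : ℤˣ} (h : G.IsLink e u v s)
    (h' : G.IsLink e u' v' s') : s(u, v) = s(u', v') ∧ s = s' := by
  obtain ⟨_, h⟩ := h
  obtain ⟨_, h'⟩ := h'
  rw [h] at h'
  injection h' with h1 h2
  exact ⟨h1, h2⟩

theorem edge_cases (G : SignedGraph V E) (e : E) :
    (∃ u v s, G.IsLink e u v s) ∨ G.IsLoop e ∨ G.IsHalfedge e := by
  unfold IsLink IsLoop IsHalfedge IsLoopAt IsHalfedgeAt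
  rcases h : G.edge e with ⟨p, hp, s⟩ | v | v
  · induction p with
    | h u v => exact Or.inl ⟨u, v, s, hp, rfl⟩
  · exact Or.inr (Or.inl ⟨v, rfl⟩)
  · exact Or.inr (Or.inr ⟨v, rfl⟩)

theorem IsLink.not_isLoop {e : E} {u v : V} {s : ℤˣ} (h : G.IsLink e u v s) : ¬ G.IsLoop e := by
  rintro ⟨w, hw⟩
  obtain ⟨_, h⟩ := h
  rw [IsLoopAt, h] at hw
  cases hw

theorem IsLink.not_isHalfedge {e : E} {u v : V} {s : ℤˣ} (h : G.IsLink e u v s) :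
    ¬ G.IsHalfedge e := by
  rintro ⟨w, hw⟩
  obtain ⟨_, h⟩ := h
  rw [IsHalfedgeAt, h] at hw
  cases hw

theorem IsLoop.not_isHalfedge {e : E} (h : G.IsLoop e) : ¬ G.IsHalfedge e := by
  rintro ⟨w, hw⟩
  obtain ⟨v, h⟩ := h
  rw [IsLoopAt] at h
  rw [IsHalfedgeAt, h] at hw
  cases hw

theorem IsLink.incident_iff {e : E} {u v w : V} {s : ℤˣ} (h : G.IsLink e u v s) :
    G.Incident w e ↔ w = u ∨ w = v := by
  constructor
  · rintro (⟨z, s', h'⟩ | h' | h')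
    · have := (h.eq_and_eq h').1
      rw [Sym2.eq_iff] at this
      rcases this with ⟨rfl, rfl⟩ | ⟨rfl, rfl⟩ <;> simp
    · exact absurd ⟨w, h'⟩ h.not_isLoop
    · exact absurd ⟨w, h'⟩ h.not_isHalfedge
  · rintro (rfl | rfl)
    · exact Or.inl ⟨v, s, h.symm⟩
    · exact Or.inl ⟨u, s, h⟩

theorem IsLoopAt.incident_iff {e : E} {v w : V} (h : G.IsLoopAt e v) :
    G.Incident w e ↔ w = v := by
  constructor
  · rintro (⟨z, s', h'⟩ | h' | h')
    · exact absurd ⟨v, h⟩ h'.not_isLoop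
    · rw [IsLoopAt] at h h'
      rw [h] at h'
      injection h' with h'
      exact h'.symm
    · exact absurd ⟨w, h'⟩ (IsLoop.not_isHalfedge ⟨v, h⟩)
  · rintro rfl
    exact Or.inr (Or.inl h)

theorem IsHalfedgeAt.incident_iff {e : E} {v w : V} (h : G.IsHalfedgeAt e v) :
    G.Incident w e ↔ w = v := by
  constructor
  · rintro (⟨z, s', h'⟩ | h' | h')
    · exact absurd ⟨v, h⟩ h'.not_isHalfedge
    · exact absurd ⟨v, h⟩ (IsLoop.not_isHalfedge ⟨w, h'⟩)
    · rw [IsHalfedgeAt] at h h'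
      rw [h] at h'
      injection h' with h'
      exact h'.symm
  · rintro rfl
    exact Or.inr (Or.inr h)

theorem exists_incident (G : SignedGraph V E) (e : E) : ∃ v, G.Incident v e := by
  rcases G.edge_cases e with ⟨u, v, s, h⟩ | ⟨v, h⟩ | ⟨v, h⟩
  · exact ⟨u, h.incident_iff.2 (Or.inl rfl)⟩
  · exact ⟨v, h.incident_iff.2 rfl⟩
  · exact ⟨v, h.incident_iff.2 rfl⟩

end Edges

/-! ### Node labellings orthogonal to columns -/

section EdgeHom

variable {X Y : Type*} [AddCommGroup X] [AddCommGroup Y]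

/-- The pairing of the column of `e` in the incidence matrix with a node labelling. -/
def edgeHom (G : SignedGraph V E) (τ : V → E → ℤˣ) (e : E) : (V → X) →+ X where
  toFun y := match G.edge e with
    | SignedEdge.link p _ _ =>
      Sym2.lift ⟨fun u v => τ u e • y u + τ v e • y v, fun _ _ => add_comm _ _⟩ p
    | SignedEdge.negLoop v => 2 • τ v e • y v
    | SignedEdge.halfedge v => τ v e • y v
  map_zero' := by
    rcases G.edge e with ⟨p, hp, s⟩ | v | v
    · induction p with
      | h u v => simp
    · simp
    · simp
  map_add' y z := by
    rcases G.edge e with ⟨p, hp, s⟩ | v | v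
    · induction p with
      | h u v => simp only [Sym2.lift_mk, Pi.add_apply, smul_add]; abel
    · simp only [Pi.add_apply, smul_add]
    · simp only [Pi.add_apply, smul_add]

variable {τ : V → E → ℤˣ} {e : E} {u v : V} {s : ℤˣ}

theorem IsLink.edgeHom_apply (h : G.IsLink e u v s) (y : V → X) :
    G.edgeHom τ e y = τ u e • y u + τ v e • y v := by
  obtain ⟨_, h⟩ := h
  simp [edgeHom, h]

theorem IsLoopAt.edgeHom_apply (h : G.IsLoopAt e v) (y : V → X) :
    G.edgeHom τ e y = 2 • τ v e • y v := by
  rw [IsLoopAt] at h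
  simp only [edgeHom, h, AddMonoidHom.coe_mk, ZeroHom.coe_mk]

theorem IsHalfedgeAt.edgeHom_apply (h : G.IsHalfedgeAt e v) (y : V → X) :
    G.edgeHom τ e y = τ v e • y v := by
  rw [IsHalfedgeAt] at h
  simp [edgeHom, h]

/-- The orientation enters only through σ = -τ(u)τ(v): a link in the kernel condition transports
labels by its sign. -/
theorem IsLink.edgeHom_eq_zero_iff (hτ : G.IsOrientation τ) (h : G.IsLink e u v s) (y : V → X) :
    G.edgeHom τ e y = 0 ↔ y v = s • y u := by
  rw [h.edgeHom_apply, hτ e u v s h, add_comm, add_eq_zero_iff_eq_neg]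
  constructor
  · intro h
    rw [← inv_smul_smul (τ v e) (y v), h, Int.units_inv_eq_self, smul_neg, mul_comm,
      Units.neg_smul, mul_smul]
  · intro h
    rw [h, Units.neg_smul, smul_neg, mul_comm, mul_smul, ← Int.units_inv_eq_self (τ v e),
      Int.units_inv_eq_self (τ v e), smul_smul (τ v e) (τ v e), Int.units_mul_self, one_smul]

theorem IsLoopAt.edgeHom_eq_zero_iff (h : G.IsLoopAt e v) (y : V → X) :
    G.edgeHom τ e y = 0 ↔ 2 • y v = 0 := by
  rw [h.edgeHom_apply, smul_comm, smul_eq_zero_iff_eq]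

theorem IsHalfedgeAt.edgeHom_eq_zero_iff (h : G.IsHalfedgeAt e v) (y : V → X) :
    G.edgeHom τ e y = 0 ↔ y v = 0 := by
  rw [h.edgeHom_apply, smul_eq_zero_iff_eq]

/-- Used for the reduction ℝ → ℝ/ℤ and for multiplication by a real number. -/
theorem edgeHom_comp (f : X →+ Y) (y : V → X) :
    G.edgeHom τ e (f ∘ y) = f (G.edgeHom τ e y) := by
  have hs : ∀ (s : ℤˣ) (x : X), f (s • x) = s • f x := fun s x => by
    rw [Units.smul_def, Units.smul_def, map_zsmul]
  rcases G.edge_cases e with ⟨u, v, s, h⟩ | ⟨v, h⟩ | ⟨v, h⟩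
  · simp [h.edgeHom_apply, hs]
  · rw [h.edgeHom_apply, h.edgeHom_apply, map_nsmul, hs, Function.comp_apply]
  · rw [h.edgeHom_apply, h.edgeHom_apply, hs, Function.comp_apply]

theorem vecMul_incidenceMatrix [Fintype V] [DecidableEq V] (x : V → ℝ) (e : E) :
    Matrix.vecMul x (G.incidenceMatrix τ) e = G.edgeHom τ e x := by
  rw [Matrix.vecMul, dotProduct]
  rcases G.edge_cases e with ⟨u, v, s, h⟩ | ⟨v, h⟩ | ⟨v, h⟩
  · rw [h.edgeHom_apply]
    have hne := h.ne
    obtain ⟨_, h⟩ := h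
    rw [← Finset.sum_subset (Finset.subset_univ {u, v}), Finset.sum_pair hne]
    · simp [incidenceMatrix, h, Units.smul_def, mul_comm]
    · intro w _ hw
      simp only [Finset.mem_insert, Finset.mem_singleton] at hw
      simp [incidenceMatrix, h, hw]
  · rw [h.edgeHom_apply]
    rw [IsLoopAt] at h
    simp [incidenceMatrix, h, Units.smul_def]
    ring
  · rw [h.edgeHom_apply]
    rw [IsHalfedgeAt] at h
    simp [incidenceMatrix, h, Units.smul_def, mul_comm]

/-- The node labellings that are orthogonal to all columns in `F`. -/
def edgeKer (X : Type*) [AddCommGroup X] (G : SignedGraph V E) (τ : V → E → ℤˣ) (F : Finset E) :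
    AddSubgroup (V → X) :=
  ⨅ e ∈ F, (G.edgeHom τ e).ker

theorem mem_edgeKer {F : Finset E} {y : V → X} :
    y ∈ G.edgeKer X τ F ↔ ∀ e ∈ F, G.edgeHom τ e y = 0 := by
  simp [edgeKer, AddSubgroup.mem_iInf]

theorem edgeKer_anti {F F' : Finset E} (h : F ⊆ F') : G.edgeKer X τ F' ≤ G.edgeKer X τ F :=
  fun _ hy => mem_edgeKer.2 fun e he => mem_edgeKer.1 hy e (h he)

end EdgeHom

end SignedGraph

/-! ### Circles and the transport of labels along links -/

namespace SignedGraph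

variable {V E : Type*} {G : SignedGraph V E}

section Circles

theorem odd_iff_neg_one_pow_eq {n : ℕ} : Odd n ↔ (-1 : ℤˣ) ^ n = -1 := by
  rcases Nat.even_or_odd n with h | h
  · rw [h.neg_one_pow]
    exact ⟨fun h' => absurd h (Nat.not_even_iff_odd.2 h'), fun h' => absurd h' (by decide)⟩
  · simp [h, h.neg_one_pow]

theorem IsLink.isNegLink_iff {e : E} {u v : V} {s : ℤˣ} (h : G.IsLink e u v s) :
    G.IsNegLink e ↔ s = -1 := by
  constructor
  · rintro ⟨u', v', h'⟩
    exact (h.eq_and_eq h').2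
  · rintro rfl
    exact ⟨u, v, h⟩

theorem IsCircle.exists_data {C : Set E} (hC : G.IsCircle C) :
    ∃ (k : ℕ) (v : Fin (k + 2) → V) (e : Fin (k + 2) → E) (s : Fin (k + 2) → ℤˣ),
      Function.Injective e ∧ (∀ i, G.IsLink (e i) (v i) (v (i + 1)) (s i)) ∧ C = Set.range e ∧
      (Odd {e | e ∈ C ∧ G.IsNegLink e}.ncard ↔ ∏ i, s i = -1) := by
  obtain ⟨k, v, e, -, he, hl, rfl⟩ := hC
  choose s hs using hl
  refine ⟨k, v, e, s, he, hs, rfl, ?_⟩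
  have h1 : {f | f ∈ Set.range e ∧ G.IsNegLink f} =
      e '' ((Finset.univ.filter fun i => s i = -1 : Finset (Fin (k + 2))) : Set (Fin (k + 2))) := by
    ext f
    constructor
    · rintro ⟨⟨i, rfl⟩, hf⟩
      exact ⟨i, by simpa using (hs i).isNegLink_iff.1 hf, rfl⟩
    · rintro ⟨i, hi, rfl⟩
      exact ⟨⟨i, rfl⟩, (hs i).isNegLink_iff.2 (by simpa using hi)⟩
  have h2 : ∏ i, s i = (-1) ^ (Finset.univ.filter fun i => s i = -1).card := by
    rw [← Finset.prod_const, Finset.prod_filter]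
    refine Finset.prod_congr rfl fun i _ => ?_
    split_ifs with h
    · exact h
    · exact (Int.units_eq_one_or (s i)).resolve_right h
  rw [h1, Set.ncard_image_of_injective _ he, Set.ncard_coe_finset, h2, odd_iff_neg_one_pow_eq]

theorem IsCircle.exists_isLink {C : Set E} (hC : G.IsCircle C) {e : E} (he : e ∈ C) :
    ∃ u v s, G.IsLink e u v s := by
  obtain ⟨k, v, e, s, -, hl, rfl, -⟩ := hC.exists_data
  obtain ⟨i, rfl⟩ := he
  exact ⟨_, _, _, hl i⟩

theorem IsCircle.nonempty {C : Set E} (hC : G.IsCircle C) : C.Nonempty := by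
  obtain ⟨k, v, e, s, -, -, rfl, -⟩ := hC.exists_data
  exact ⟨e 0, 0, rfl⟩

variable {F : Finset E}

theorem IsLink.adj {e : E} {u v : V} {s : ℤˣ} (h : G.IsLink e u v s) (he : e ∈ F) :
    (G.linkGraph F).Adj u v := ⟨e, he, s, h⟩

theorem reachable_induction {u v : V} (h : (G.linkGraph F).Reachable u v) {P : V → Prop}
    (step : ∀ e ∈ F, ∀ u v s, G.IsLink e u v s → P u → P v) (hu : P u) : P v := by
  obtain ⟨p⟩ := h
  induction p with
  | nil => exact hu
  | cons hadj _ ih =>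
    obtain ⟨e, he, s, hl⟩ := hadj
    exact ih (step e he _ _ s hl hu)

theorem IsCircle.reachable_of_incident {C : Set E} (hC : G.IsCircle C)
    (hCF : C ⊆ F) {f f' : E} (hf : f ∈ C) (hf' : f' ∈ C) {w w' : V} (hw : G.Incident w f)
    (hw' : G.Incident w' f') : (G.linkGraph F).Reachable w w' := by
  obtain ⟨k, v, e, s, -, hl, rfl, -⟩ := hC.exists_data
  have hadj : ∀ i, (G.linkGraph F).Reachable (v i) (v (i + 1)) := fun i =>
    ((hl i).adj (hCF ⟨i, rfl⟩)).reachable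
  have h0 : ∀ i, (G.linkGraph F).Reachable (v (0 + 1)) (v i) :=
    fin_cycle_induction (P := fun i => (G.linkGraph F).Reachable (v (0 + 1)) (v i)) 0
      (SimpleGraph.Reachable.refl _) fun i _ h => h.trans (hadj i)
  have key : ∀ f ∈ Set.range e, ∀ w, G.Incident w f →
      (G.linkGraph F).Reachable (v (0 + 1)) w := by
    rintro _ ⟨i, rfl⟩ w hw
    rcases (hl i).incident_iff.1 hw with rfl | rfl
    · exact h0 _
    · exact h0 _
  exact (key f hf w hw).symm.trans (key f' hf' w' hw')

theorem IsCircle.reachable_of_isLink {C : Set E} (hC : G.IsCircle C) {e : E}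
    (hCF : ∀ f ∈ C, f ≠ e → f ∈ F) (he : e ∈ C) {u v : V} {s : ℤˣ} (h : G.IsLink e u v s) :
    (G.linkGraph F).Reachable u v := by
  obtain ⟨k, w, f, s', hinj, hl, rfl, -⟩ := hC.exists_data
  obtain ⟨j, rfl⟩ := he
  have h0 : ∀ i, (G.linkGraph F).Reachable (w (j + 1)) (w i) :=
    fin_cycle_induction (P := fun i => (G.linkGraph F).Reachable (w (j + 1)) (w i)) j
      (SimpleGraph.Reachable.refl _) fun i hi h =>
        h.trans ((hl i).adj (hCF _ ⟨i, rfl⟩ fun h => hi (hinj h))).reachable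
  have := (h.eq_and_eq (hl j)).1
  rw [Sym2.eq_iff] at this
  rcases this with ⟨rfl, rfl⟩ | ⟨rfl, rfl⟩
  · exact (h0 j).symm
  · exact h0 j

/-- A path in `F` between the ends is closed up by `e`. Since `e ∉ F`, this also works for a path of
length one, where the circle consists of two parallel links. -/
theorem IsLink.exists_isCircle {e : E} {u v : V} {s : ℤˣ} (h : G.IsLink e u v s) (he : e ∉ F)
    (hr : (G.linkGraph F).Reachable u v) :
    ∃ C, G.IsCircle C ∧ e ∈ C ∧ ∀ f ∈ C, f ≠ e → f ∈ F := by
  obtain ⟨p, hp⟩ := hr.exists_isPath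
  have hlen : p.length ≠ 0 := fun h0 => h.ne (SimpleGraph.Walk.eq_of_length_eq_zero h0)
  obtain ⟨k, hk⟩ := Nat.exists_eq_succ_of_ne_zero hlen
  have hinj := hp.getVert_injOn
  -- Indices up to `k` carry the edges of the path; the last index `k + 1` carries `e`, from v back
  -- to u.
  have hchoice : ∀ i : Fin (k + 2), ∃ f, (i.val < k + 1 → f ∈ F) ∧ (i.val = k + 1 → f = e) ∧
      ∃ s, G.IsLink f (p.getVert i) (p.getVert (i + 1 : Fin (k + 2))) s := by
    intro i
    by_cases hi : i.val < k + 1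
    · obtain ⟨f, hf, t, hl⟩ := p.adj_getVert_succ (i := i.val) (by omega)
      refine ⟨f, fun _ => hf, fun h => by omega, t, ?_⟩
      rwa [Fin.val_add_one_of_lt' (by omega)]
    · have hi' : i = Fin.last (k + 1) := Fin.ext (by simp; omega)
      subst hi'
      refine ⟨e, fun h => absurd h hi, fun _ => rfl, s, ?_⟩
      rw [Fin.last_add_one]
      have : p.getVert (Fin.last (k + 1)).val = v := by
        simp [← Nat.succ_eq_add_one, ← hk]
      rw [this]
      simpa using h.symm
  choose f hf1 hf2 hf3 using hchoice
  have hval : ∀ i : Fin (k + 2), i.val < k + 1 → (i + 1 : Fin (k + 2)).val = i.val + 1 :=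
    fun i hi => Fin.val_add_one_of_lt' (by omega)
  refine ⟨Set.range f, ⟨k, fun i => p.getVert i, f, ?_, ?_, hf3, rfl⟩, ?_, ?_⟩
  · intro i j hij
    exact Fin.ext (hinj (by simp; omega) (by simp; omega) hij)
  · intro i j hij
    by_cases hi : i.val < k + 1 <;> by_cases hj : j.val < k + 1
    · obtain ⟨s₁, h₁⟩ := hf3 i
      obtain ⟨s₂, h₂⟩ := hf3 j
      rw [hij] at h₁
      have := (h₁.eq_and_eq h₂).1
      rw [Sym2.eq_iff, hval i hi, hval j hj] at this
      rcases this with ⟨ha, hb⟩ | ⟨ha, hb⟩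
      · exact Fin.ext (hinj (by simp; omega) (by simp; omega) ha)
      · have h1 := hinj (by simp; omega) (by simp; omega) ha
        have h2 := hinj (by simp; omega) (by simp; omega) hb
        omega
    · exact absurd (hf2 j (by omega) ▸ hij ▸ hf1 i hi) he
    · exact absurd (hf2 i (by omega) ▸ hij ▸ hf1 j hj) he
    · exact Fin.ext (by omega)
  · exact ⟨Fin.last (k + 1), hf2 _ rfl⟩
  · rintro _ ⟨i, rfl⟩ hne
    by_contra hi
    refine hne (hf2 i ?_)
    have : ¬ i.val < k + 1 := fun h => hi (hf1 i h)
    omega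

end Circles

section Labellings

variable {X : Type*} [AddCommGroup X] {τ : V → E → ℤˣ}

/-- Transport once around an odd circle gives y = -y. -/
theorem IsCircle.two_nsmul_eq_zero (hτ : G.IsOrientation τ) {C : Set E} (hC : G.IsCircle C)
    (hodd : Odd {e | e ∈ C ∧ G.IsNegLink e}.ncard) {y : V → X}
    (hy : ∀ e ∈ C, G.edgeHom τ e y = 0) {e : E} (he : e ∈ C) {w : V} (hw : G.Incident w e) :
    2 • y w = 0 := by
  obtain ⟨k, v, f, s, hinj, hl, rfl, hs⟩ := hC.exists_data
  rw [hs] at hodd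
  have hstep : ∀ i, y (v (i + 1)) = s i • y (v i) := fun i =>
    ((hl i).edgeHom_eq_zero_iff hτ y).1 (hy _ ⟨i, rfl⟩)
  have key : ∀ i, 2 • y (v (i + 1)) = 0 := by
    intro i
    have := cyclic_smul (fun i => y (v i)) s i fun i _ => hstep i
    simp only [hodd, ← hstep i, Units.neg_smul, one_smul] at this
    rw [two_nsmul]
    exact add_eq_zero_iff_eq_neg.2 this
  have key' : ∀ i, 2 • y (v i) = 0 := fun i => by simpa using key (i - 1)
  obtain ⟨i, rfl⟩ := he
  rcases (hl i).incident_iff.1 hw with rfl | rfl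
  · exact key' _
  · exact key' _

/-- The equation of the last edge follows from the others whenever transport around the circle is
trivial: the sign product is 1, or signs act trivially because all labels are 2-torsion. -/
theorem IsCircle.edgeHom_eq_zero (hτ : G.IsOrientation τ) {C : Set E} (hC : G.IsCircle C)
    {e : E} (he : e ∈ C) {y : V → X}
    (h : ¬ Odd {e | e ∈ C ∧ G.IsNegLink e}.ncard ∨ ∀ w, 2 • y w = 0)
    (hy : ∀ f ∈ C, f ≠ e → G.edgeHom τ f y = 0) :
    G.edgeHom τ e y = 0 := by
  obtain ⟨k, v, f, s, hinj, hl, rfl, hs⟩ := hC.exists_data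
  obtain ⟨j, rfl⟩ := he
  rw [hs] at h
  have := cyclic_smul (fun i => y (v i)) s j fun i hi =>
    ((hl i).edgeHom_eq_zero_iff hτ y).1 (hy _ ⟨i, rfl⟩ fun h => hi (hinj h))
  rw [(hl j).edgeHom_eq_zero_iff hτ, this]
  rcases Int.units_eq_one_or (∏ i, s i) with h1 | h1
  · rw [h1, one_smul]
  · rw [h1, Units.neg_smul, one_smul]
    have := (h.resolve_left (not_not.2 h1)) (v (j + 1))
    rw [two_nsmul] at this
    exact eq_neg_of_add_eq_zero_left this

theorem units_smul_of_two_nsmul {x : X} (h : 2 • x = 0) (s : ℤˣ) : s • x = x := by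
  rcases Int.units_eq_one_or s with rfl | rfl
  · exact one_smul _ x
  · rw [Units.neg_smul, one_smul]
    rw [two_nsmul] at h
    exact (eq_neg_of_add_eq_zero_left h).symm

variable {F : Finset E} {y : V → X} {u v : V}

theorem eq_zero_of_reachable (hτ : G.IsOrientation τ) (hy : y ∈ G.edgeKer X τ F)
    (h : (G.linkGraph F).Reachable u v) (hu : y u = 0) : y v = 0 :=
  reachable_induction h (P := fun w => y w = 0) (fun e he u v s hl hu => by
    rw [(hl.edgeHom_eq_zero_iff hτ y).1 (mem_edgeKer.1 hy e he), hu, smul_zero]) hu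

theorem two_nsmul_eq_zero_of_reachable (hτ : G.IsOrientation τ) (hy : y ∈ G.edgeKer X τ F)
    (h : (G.linkGraph F).Reachable u v) (hu : 2 • y u = 0) : 2 • y v = 0 :=
  reachable_induction h (P := fun w => 2 • y w = 0) (fun e he u v s hl hu => by
    rw [(hl.edgeHom_eq_zero_iff hτ y).1 (mem_edgeKer.1 hy e he),
      units_smul_of_two_nsmul hu, hu]) hu

theorem eq_of_reachable (hτ : G.IsOrientation τ) (hy : y ∈ G.edgeKer X τ F)
    (h2 : ∀ w, 2 • y w = 0) (h : (G.linkGraph F).Reachable u v) : y v = y u :=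
  reachable_induction h (P := fun w => y w = y u) (fun e he a b s hl ha => by
    rw [(hl.edgeHom_eq_zero_iff hτ y).1 (mem_edgeKer.1 hy e he),
      units_smul_of_two_nsmul (h2 a), ha]) rfl

end Labellings

end SignedGraph

/-! ### Component types, switching and balance -/

namespace SignedGraph

variable {V E : Type*} {G : SignedGraph V E} {τ : V → E → ℤˣ}

section Features

/-- The edges in `F` with an end in `K`. -/
def edgesAt (G : SignedGraph V E) (F : Finset E) (K : Set V) : Set E :=
  {e | e ∈ F ∧ ∃ v ∈ K, G.Incident v e}

/-- Circles, loops and halfedges: the edge sets that distinguish a component from a tree. -/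
def IsFeature (G : SignedGraph V E) (Φ : Set E) : Prop :=
  G.IsCircle Φ ∨ ∃ e, Φ = {e} ∧ (G.IsLoop e ∨ G.IsHalfedge e)

theorem IsFeature.nonempty {Φ : Set E} (h : G.IsFeature Φ) : Φ.Nonempty := by
  rcases h with h | ⟨e, rfl, -⟩
  · exact h.nonempty
  · exact Set.singleton_nonempty e

theorem IsLoop.isFeature {e : E} (h : G.IsLoop e) : G.IsFeature {e} := Or.inr ⟨e, rfl, Or.inl h⟩

theorem IsHalfedge.isFeature {e : E} (h : G.IsHalfedge e) : G.IsFeature {e} :=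
  Or.inr ⟨e, rfl, Or.inr h⟩

theorem IsFeature.reachable_of_incident {F : Finset E} {Φ : Set E} (hΦ : G.IsFeature Φ)
    (hΦF : Φ ⊆ F) {f f' : E} (hf : f ∈ Φ) (hf' : f' ∈ Φ) {w w' : V} (hw : G.Incident w f)
    (hw' : G.Incident w' f') : (G.linkGraph F).Reachable w w' := by
  rcases hΦ with hΦ | ⟨e, rfl, he⟩
  · exact hΦ.reachable_of_incident hΦF hf hf' hw hw'
  · obtain rfl : f = e := hf
    obtain rfl : f' = f := hf'
    have : w = w' := by
      rcases he with ⟨v, he⟩ | ⟨v, he⟩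
      · rw [he.incident_iff.1 hw, he.incident_iff.1 hw']
      · rw [he.incident_iff.1 hw, he.incident_iff.1 hw']
    rw [this]

/-- The four types are the four possibilities for a component with at most one feature: none, a
halfedge, a loop, or an odd circle. In this uniform form they can be compared with linear
independence. -/
theorem comp_types_iff {F : Finset E} {c : (G.linkGraph F).ConnectedComponent} :
    (G.IsTreeComp F c ∨ G.IsHalfedgeTreeComp F c ∨ G.IsLoopTreeComp F c ∨
      G.IsPseudoTreeComp F c) ↔
    (∀ Φ Φ', Φ ⊆ G.compEdges F c → Φ' ⊆ G.compEdges F c → G.IsFeature Φ → G.IsFeature Φ' →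
      Φ = Φ') ∧
    ∀ C ⊆ G.compEdges F c, G.IsCircle C → Odd {e | e ∈ C ∧ G.IsNegLink e}.ncard := by
  constructor
  · have huniq : ∀ Ψ, (∀ Φ ⊆ G.compEdges F c, G.IsFeature Φ → Φ = Ψ) →
        ∀ Φ Φ', Φ ⊆ G.compEdges F c → Φ' ⊆ G.compEdges F c → G.IsFeature Φ → G.IsFeature Φ' →
          Φ = Φ' := fun Ψ h Φ Φ' h1 h2 h3 h4 => (h Φ h1 h3).trans (h Φ' h2 h4).symm
    rintro (⟨h1, h2, h3⟩ | ⟨h1, h2, ⟨e, -, he⟩⟩ | ⟨h1, ⟨e, -, he⟩, h3⟩ |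
      ⟨⟨C, -, hC, hodd, hu⟩, h2, h3⟩)
    · refine ⟨huniq ∅ ?_, fun C hC hC' => absurd hC' (h1 C hC)⟩
      rintro Φ hΦ (h | ⟨f, rfl, h | h⟩)
      · exact absurd h (h1 Φ hΦ)
      · exact absurd h (h2 f (hΦ rfl))
      · exact absurd h (h3 f (hΦ rfl))
    · refine ⟨huniq {e} ?_, fun C hC hC' => absurd hC' (h1 C hC)⟩
      rintro Φ hΦ (h | ⟨f, rfl, h | h⟩)
      · exact absurd h (h1 Φ hΦ)
      · exact absurd h (h2 f (hΦ rfl))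
      · rw [he f ⟨hΦ rfl, h⟩]
    · refine ⟨huniq {e} ?_, fun C hC hC' => absurd hC' (h1 C hC)⟩
      rintro Φ hΦ (h | ⟨f, rfl, h | h⟩)
      · exact absurd h (h1 Φ hΦ)
      · rw [he f ⟨hΦ rfl, h⟩]
      · exact absurd h (h3 f (hΦ rfl))
    · refine ⟨huniq C ?_, fun C' hC' h => by rwa [hu C' hC' h]⟩
      rintro Φ hΦ (h | ⟨f, rfl, h | h⟩)
      · exact hu Φ hΦ h
      · exact absurd h (h2 f (hΦ rfl))
      · exact absurd h (h3 f (hΦ rfl))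
  · rintro ⟨hu, hodd⟩
    have hs : ∀ e ∈ G.compEdges F c, ({e} : Set E) ⊆ G.compEdges F c := fun e he => by
      simpa using he
    by_cases hC : ∃ C ⊆ G.compEdges F c, G.IsCircle C
    · obtain ⟨C, hC, hCc⟩ := hC
      have hne : ∀ e, G.IsFeature {e} → e ∈ G.compEdges F c → ¬ (G.IsLoop e ∨ G.IsHalfedge e) := by
        intro e he hec hlh
        have := hu C {e} hC (hs e hec) (Or.inl hCc) he
        obtain ⟨u, v, s, hl⟩ := hCc.exists_isLink (e := e) (by rw [this]; rfl)
        rcases hlh with h | h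
        · exact hl.not_isLoop h
        · exact hl.not_isHalfedge h
      exact Or.inr (Or.inr (Or.inr ⟨⟨C, hC, hCc, hodd C hC hCc, fun C' hC' h =>
        hu C' C hC' hC (Or.inl h) (Or.inl hCc)⟩,
        fun e he h => hne e h.isFeature he (Or.inl h),
        fun e he h => hne e h.isFeature he (Or.inr h)⟩))
    · push Not at hC
      have hne : ∀ e f, e ∈ G.compEdges F c → f ∈ G.compEdges F c → G.IsFeature {e} →
          G.IsFeature {f} → e = f := fun e f he hf h h' =>
        Set.singleton_injective (hu _ _ (hs e he) (hs f hf) h h')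
      by_cases hh : ∃ e ∈ G.compEdges F c, G.IsHalfedge e
      · obtain ⟨e, he, heh⟩ := hh
        refine Or.inr (Or.inl ⟨hC, fun f hf h => ?_, e, ⟨he, heh⟩, fun f hf =>
          hne f e hf.1 he hf.2.isFeature heh.isFeature⟩)
        exact h.not_isHalfedge (hne e f he hf heh.isFeature h.isFeature ▸ heh)
      · push Not at hh
        by_cases hl : ∃ e ∈ G.compEdges F c, G.IsLoop e
        · obtain ⟨e, he, hel⟩ := hl
          exact Or.inr (Or.inr (Or.inl ⟨hC, ⟨e, ⟨he, hel⟩, fun f hf =>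
            hne f e hf.1 he hf.2.isFeature hel.isFeature⟩, hh⟩))
        · push Not at hl
          exact Or.inl ⟨hC, hl, hh⟩

theorem isTreeComp_iff {F : Finset E} {c : (G.linkGraph F).ConnectedComponent} :
    G.IsTreeComp F c ↔ ∀ Φ ⊆ G.compEdges F c, ¬ G.IsFeature Φ := by
  constructor
  · rintro ⟨h1, h2, h3⟩ Φ hΦ (h | ⟨f, rfl, h | h⟩)
    · exact h1 Φ hΦ h
    · exact h2 f (hΦ rfl) h
    · exact h3 f (hΦ rfl) h
  · intro h
    exact ⟨fun C hC h' => h C hC (Or.inl h'),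
      fun e he h' => h {e} (by simpa using he) h'.isFeature,
      fun e he h' => h {e} (by simpa using he) h'.isFeature⟩

end Features

section Balance

/-- Edges are added one at a time. Without circles a new link joins two different components, and
switching one of them as a whole adapts the signs to the new link. -/
theorem exists_switching [DecidableEq E] (F : Finset E) (hF : ∀ C, G.IsCircle C → ¬ C ⊆ F) :
    ∃ x : V → ℤˣ, ∀ e ∈ F, ∀ u v s, G.IsLink e u v s → x v = s * x u := by
  classical
  induction F using Finset.induction_on with
  | empty => exact ⟨1, by simp⟩
  | insert e F he ih =>
    obtain ⟨x, hx⟩ := ih fun C hC h => hF C hC (h.trans (by simp))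
    by_cases hl : ∃ u v s, G.IsLink e u v s
    swap
    · refine ⟨x, fun f hf u v s h => ?_⟩
      rcases Finset.mem_insert.1 hf with rfl | hf
      · exact absurd ⟨u, v, s, h⟩ hl
      · exact hx f hf u v s h
    obtain ⟨u, v, s, hl⟩ := hl
    have hr : ¬ (G.linkGraph F).Reachable u v := by
      intro hr
      obtain ⟨C, hC, -, hCF⟩ := hl.exists_isCircle he hr
      refine hF C hC fun f hf => ?_
      rw [Finset.coe_insert]
      by_cases hfe : f = e
      · exact Or.inl hfe
      · exact Or.inr (hCF f hf hfe)
    have hss : ∀ t : ℤˣ, t * t = 1 := Int.units_mul_self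
    -- The constant factor s * x u * x v on the component of v turns the value at v into s * x u.
    refine ⟨fun w => if (G.linkGraph F).Reachable v w then s * x u * (x v * x w) else x w, ?_⟩
    intro f hf a b t hab
    rcases Finset.mem_insert.1 hf with rfl | hf
    · obtain ⟨h1, rfl⟩ := hl.eq_and_eq hab
      have hvu : ¬ (G.linkGraph F).Reachable v u := fun h => hr h.symm
      rw [Sym2.eq_iff] at h1
      rcases h1 with ⟨rfl, rfl⟩ | ⟨rfl, rfl⟩
      · simp [hvu, hss]
      · simp [hvu, hss, ← mul_assoc]
    · have h1 := hx f hf a b t hab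
      have h2 : (G.linkGraph F).Reachable v a ↔ (G.linkGraph F).Reachable v b :=
        ⟨fun h => h.trans (hab.adj hf).reachable, fun h => h.trans (hab.adj hf).reachable.symm⟩
      simp only [h2, h1]
      split_ifs
      · rw [mul_left_comm (x v), mul_left_comm]
      · rfl

/-- A union of components without circles, loops and halfedges supports an element of the left
kernel of the incidence matrix. -/
theorem exists_mem_edgeKer (hτ : G.IsOrientation τ) {F : Finset E} {K : Set V}
    (hK : ∀ e ∈ F, ∀ u v s, G.IsLink e u v s → u ∈ K → v ∈ K)
    (hno : ∀ Φ ⊆ G.edgesAt F K, ¬ G.IsFeature Φ) :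
    ∃ x ∈ G.edgeKer ℝ τ F, ∀ v, x v ≠ 0 ↔ v ∈ K := by
  classical
  obtain ⟨x, hx⟩ := exists_switching (G := G) (F.filter fun e => e ∈ G.edgesAt F K)
    fun C hC h => hno C (fun e he => (Finset.mem_filter.1 (h he)).2) (Or.inl hC)
  refine ⟨fun v => if v ∈ K then ((x v : ℤ) : ℝ) else 0, mem_edgeKer.2 fun e he => ?_, fun v => ?_⟩
  · rcases G.edge_cases e with ⟨u, v, s, h⟩ | ⟨v, h⟩ | ⟨v, h⟩
    · rw [h.edgeHom_eq_zero_iff hτ]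
      by_cases hu : u ∈ K
      · have hv := hK e he u v s h hu
        have := hx e (Finset.mem_filter.2 ⟨he, he, u, hu, h.incident_iff.2 (Or.inl rfl)⟩) u v s h
        simp [hu, hv, this, Units.smul_def]
      · have hv : v ∉ K := fun hv => hu (hK e he v u s h.symm hv)
        simp [hu, hv]
    · by_cases hv : v ∈ K
      · exact absurd (IsLoop.isFeature ⟨v, h⟩) (hno {e} (by
          simpa using ⟨he, v, hv, h.incident_iff.2 rfl⟩))
      · rw [h.edgeHom_eq_zero_iff]
        simp [hv]
    · by_cases hv : v ∈ K
      · exact absurd (IsHalfedge.isFeature ⟨v, h⟩) (hno {e} (by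
          simpa using ⟨he, v, hv, h.incident_iff.2 rfl⟩))
      · rw [h.edgeHom_eq_zero_iff]
        simp [hv]
  · by_cases hv : v ∈ K
    · simp [hv]
    · simp [hv]

end Balance

end SignedGraph

/-! ### Pseudo-forests are the independent sets of columns -/

namespace SignedGraph

variable {V E : Type*} {G : SignedGraph V E} {τ : V → E → ℤˣ}

theorem linkGraph_mono {F F' : Finset E} (h : F ⊆ F') : G.linkGraph F ≤ G.linkGraph F' :=
  fun _ _ ⟨e, he, hl⟩ => ⟨e, h he, hl⟩

theorem mem_supp_mk {F : Finset E} {u v : V} :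
    u ∈ ((G.linkGraph F).connectedComponentMk v).supp ↔ (G.linkGraph F).Reachable u v := by
  rw [SimpleGraph.ConnectedComponent.mem_supp_iff, SimpleGraph.ConnectedComponent.eq]

theorem mem_supp_of_isLink {F : Finset E} {c : (G.linkGraph F).ConnectedComponent} {e : E}
    (he : e ∈ F) {u v : V} {s : ℤˣ} (h : G.IsLink e u v s) (hu : u ∈ c.supp) : v ∈ c.supp := by
  rw [SimpleGraph.ConnectedComponent.mem_supp_iff] at hu ⊢
  rw [← hu, SimpleGraph.ConnectedComponent.eq]
  exact (h.adj he).reachable.symm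

theorem mem_supp_of_incident {F : Finset E} {c : (G.linkGraph F).ConnectedComponent} {e : E}
    (he : e ∈ G.compEdges F c) {v : V} (h : G.Incident v e) : v ∈ c.supp := by
  obtain ⟨heF, w, hw, hwe⟩ := he
  rcases G.edge_cases e with ⟨a, b, s, hl⟩ | ⟨a, hl⟩ | ⟨a, hl⟩
  · rcases hl.incident_iff.1 h with rfl | rfl <;> rcases hl.incident_iff.1 hwe with rfl | rfl
    · exact hw
    · exact mem_supp_of_isLink heF hl.symm hw
    · exact mem_supp_of_isLink heF hl hw
    · exact hw
  · rwa [hl.incident_iff.1 h, ← hl.incident_iff.1 hwe]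
  · rwa [hl.incident_iff.1 h, ← hl.incident_iff.1 hwe]

theorem IsFeature.exists_two_nsmul_eq_zero {X : Type*} [AddCommGroup X] (hτ : G.IsOrientation τ)
    {Φ : Set E} (hΦ : G.IsFeature Φ)
    (hodd : G.IsCircle Φ → Odd {e | e ∈ Φ ∧ G.IsNegLink e}.ncard) {y : V → X}
    (hy : ∀ e ∈ Φ, G.edgeHom τ e y = 0) : ∃ e ∈ Φ, ∃ w, G.Incident w e ∧ 2 • y w = 0 := by
  rcases hΦ with hΦ | ⟨f, rfl, ⟨v, h⟩ | ⟨v, h⟩⟩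
  · obtain ⟨e, he⟩ := hΦ.nonempty
    obtain ⟨w, hw⟩ := G.exists_incident e
    exact ⟨e, he, w, hw, hΦ.two_nsmul_eq_zero hτ (hodd hΦ) hy he hw⟩
  · exact ⟨f, rfl, v, h.incident_iff.2 rfl, (h.edgeHom_eq_zero_iff y).1 (hy f rfl)⟩
  · exact ⟨f, rfl, v, h.incident_iff.2 rfl, by
      rw [(h.edgeHom_eq_zero_iff y).1 (hy f rfl), smul_zero]⟩

variable [DecidableEq E]

/-- The columns in `F` are linearly independent: each of them is separated from the others by
some vector. -/
def IsIndep (G : SignedGraph V E) (τ : V → E → ℤˣ) (F : Finset E) : Prop :=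
  ∀ e ∈ F, ∃ x ∈ G.edgeKer ℝ τ (F.erase e), G.edgeHom τ e x ≠ 0

/-- Without `e` the component loses its only feature, so it supports a labelling that is nonzero at
all its nodes. If `e` were orthogonal to it too, the feature would force 2x = 0 at some node. -/
theorem IsPseudoForest.exists_separating_of_feature (hτ : G.IsOrientation τ) {F : Finset E}
    (hF : G.IsPseudoForest F) {c : (G.linkGraph F).ConnectedComponent} {Φ : Set E}
    (hΦ : G.IsFeature Φ) (hΦc : Φ ⊆ G.compEdges F c) {e : E} (he : e ∈ Φ) :
    ∃ x ∈ G.edgeKer ℝ τ (F.erase e), G.edgeHom τ e x ≠ 0 := by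
  obtain ⟨huniq, hodd⟩ := comp_types_iff.1 (hF c)
  obtain ⟨x, hx, hxc⟩ := exists_mem_edgeKer (G := G) hτ (F := F.erase e) (K := c.supp)
    (fun f hf u v s hl hu => mem_supp_of_isLink (Finset.mem_of_mem_erase hf) hl hu)
    fun Ψ hΨ hΨf => by
      have := huniq Φ Ψ hΦc
        (fun f hf => ⟨Finset.mem_of_mem_erase (hΨ hf).1, (hΨ hf).2⟩) hΦ hΨf
      exact absurd (hΨ (this ▸ he)).1 (Finset.notMem_erase e F)
  refine ⟨x, hx, fun h0 => ?_⟩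
  have hne : ∀ w, G.Incident w e → x w ≠ 0 := fun w hw =>
    (hxc w).2 (mem_supp_of_incident (hΦc he) hw)
  rcases hΦ with hΦ | ⟨f, rfl, ⟨v, h⟩ | ⟨v, h⟩⟩
  · obtain ⟨w, hw⟩ := G.exists_incident e
    have := hΦ.two_nsmul_eq_zero hτ (hodd Φ hΦc hΦ) (y := x) (fun f hf => ?_) he hw
    · exact hne w hw (by simpa using this)
    · by_cases hfe : f = e
      · rwa [hfe]
      · exact mem_edgeKer.1 hx f (Finset.mem_erase.2 ⟨hfe, (hΦc hf).1⟩)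
  · obtain rfl : e = f := he
    rw [h.edgeHom_eq_zero_iff] at h0
    exact hne v (h.incident_iff.2 rfl) (by simpa using h0)
  · obtain rfl : e = f := he
    rw [h.edgeHom_eq_zero_iff] at h0
    exact hne v (h.incident_iff.2 rfl) h0

theorem IsPseudoForest.isIndep (hτ : G.IsOrientation τ) {F : Finset E}
    (hF : G.IsPseudoForest F) : G.IsIndep τ F := by
  intro e he
  have hsing : G.IsFeature {e} → ∃ x ∈ G.edgeKer ℝ τ (F.erase e), G.edgeHom τ e x ≠ 0 := by
    intro h
    obtain ⟨w, hw⟩ := G.exists_incident e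
    refine hF.exists_separating_of_feature hτ
      (c := (G.linkGraph F).connectedComponentMk w) h ?_ rfl
    simpa using ⟨he, w, mem_supp_mk.2 (SimpleGraph.Reachable.refl w), hw⟩
  rcases G.edge_cases e with ⟨u, v, s, hl⟩ | h | h
  swap
  · exact hsing h.isFeature
  swap
  · exact hsing h.isFeature
  set c := (G.linkGraph F).connectedComponentMk u with hc
  have huc : u ∈ c.supp := mem_supp_mk.2 (SimpleGraph.Reachable.refl u)
  have hvc : v ∈ c.supp := mem_supp_of_isLink he hl huc
  by_cases hr : (G.linkGraph (F.erase e)).Reachable u v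
  · obtain ⟨C, hC, heC, hCF⟩ := hl.exists_isCircle (Finset.notMem_erase e F) hr
    have hCF' : C ⊆ F := fun f hf => by
      by_cases hfe : f = e
      · rwa [hfe]
      · exact Finset.mem_of_mem_erase (hCF f hf hfe)
    refine hF.exists_separating_of_feature hτ (c := c) (Or.inl hC) (fun f hf => ?_) heC
    obtain ⟨w, hw⟩ := G.exists_incident f
    exact ⟨hCF' hf, w, mem_supp_mk.2 (hC.reachable_of_incident hCF' hf heC hw
      (hl.incident_iff.2 (Or.inl rfl))), hw⟩
  · set K : V → Set V := fun w => {z | (G.linkGraph (F.erase e)).Reachable w z} with hK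
    -- Here `e` is a bridge of `c`. A feature is connected, so it cannot lie on both sides, and
    -- uniqueness leaves one side without features; that side supports the separating vector.
    have hno : ∃ w, (w = u ∨ w = v) ∧ ∀ Φ ⊆ G.edgesAt (F.erase e) (K w), ¬ G.IsFeature Φ := by
      by_contra! hcon
      obtain ⟨Φ, hΦ, hΦf⟩ := hcon u (Or.inl rfl)
      obtain ⟨Ψ, hΨ, hΨf⟩ := hcon v (Or.inr rfl)
      have hsub : ∀ w ∈ c.supp, G.edgesAt (F.erase e) (K w) ⊆ G.compEdges F c := by
        rintro w hw f ⟨hf, z, hz, hzf⟩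
        refine ⟨Finset.mem_of_mem_erase hf, z, ?_, hzf⟩
        rw [hc, mem_supp_mk] at hw ⊢
        exact (SimpleGraph.Reachable.mono (linkGraph_mono (Finset.erase_subset e F)) hz).symm.trans
          hw
      obtain rfl := (comp_types_iff.1 (hF c)).1 Φ Ψ (hΦ.trans (hsub u huc))
        (hΨ.trans (hsub v hvc)) hΦf hΨf
      obtain ⟨f, hf⟩ := hΦf.nonempty
      obtain ⟨-, z, hz, hzf⟩ := hΦ hf
      obtain ⟨-, z', hz', hzf'⟩ := hΨ hf
      exact hr (hz.trans ((hΦf.reachable_of_incident (fun g hg => (hΦ hg).1) hf hf hzf hzf').trans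
        hz'.symm))
    obtain ⟨w, hw, hno⟩ := hno
    obtain ⟨x, hx, hxK⟩ := exists_mem_edgeKer (G := G) hτ (F := F.erase e) (K := K w)
      (fun f hf a b s hab ha => ha.trans (hab.adj hf).reachable) hno
    refine ⟨x, hx, fun h0 => ?_⟩
    have h1 : x u ≠ 0 ↔ x v ≠ 0 := by
      rw [(hl.edgeHom_eq_zero_iff hτ x).1 h0, not_iff_not, smul_eq_zero_iff_eq]
    rw [hxK, hxK] at h1
    rcases hw with rfl | rfl
    · exact hr (h1.1 (SimpleGraph.Reachable.refl _))
    · exact hr (h1.2 (SimpleGraph.Reachable.refl _)).symm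

theorem IsFeature.reachable_erase {F : Finset E} {Φ : Set E} (hΦ : G.IsFeature Φ) (hΦF : Φ ⊆ F)
    {e : E} (he : e ∈ Φ) {u v : V} (h : (G.linkGraph F).Reachable u v) :
    (G.linkGraph (F.erase e)).Reachable u v := by
  refine reachable_induction h (P := fun w => (G.linkGraph (F.erase e)).Reachable u w)
    (fun f hf a b s hl ha => ha.trans ?_) (SimpleGraph.Reachable.refl u)
  by_cases hfe : f = e
  · subst hfe
    rcases hΦ with hΦ | ⟨f, rfl, hf'⟩
    · exact hΦ.reachable_of_isLink (fun g hg hge => Finset.mem_erase.2 ⟨hge, hΦF hg⟩) he hl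
    · obtain rfl : _ = f := he
      rcases hf' with h | h
      · exact absurd h hl.not_isLoop
      · exact absurd h hl.not_isHalfedge
  · exact (hl.adj (Finset.mem_erase.2 ⟨hfe, hf⟩)).reachable

/-- An edge of an even circle is dependent on the others. If a component had two features, then for
an edge e of one that is not in the other, a vector orthogonal to the rest would vanish on the other
feature, hence on the whole component, which the deletion of e does not disconnect. So e could not
be separated. -/
theorem IsIndep.isPseudoForest (hτ : G.IsOrientation τ) {F : Finset E}
    (hF : G.IsIndep τ F) : G.IsPseudoForest F := by
  intro c
  rw [comp_types_iff]
  have hodd : ∀ C ⊆ G.compEdges F c, G.IsCircle C → Odd {e | e ∈ C ∧ G.IsNegLink e}.ncard := by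
    intro C hC hCc
    by_contra hodd
    obtain ⟨e, he⟩ := hCc.nonempty
    obtain ⟨x, hx, hxe⟩ := hF e (hC he).1
    exact hxe (hCc.edgeHom_eq_zero hτ he (Or.inl hodd) fun f hf hfe =>
      mem_edgeKer.1 hx f (Finset.mem_erase.2 ⟨hfe, (hC hf).1⟩))
  refine ⟨?_, hodd⟩
  have key : ∀ Φ Φ', Φ ⊆ G.compEdges F c → Φ' ⊆ G.compEdges F c → G.IsFeature Φ →
      G.IsFeature Φ' → Φ ⊆ Φ' := by
    intro Φ Φ' hΦc hΦc' hΦ hΦ' e he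
    by_contra he'
    obtain ⟨x, hx, hxe⟩ := hF e (hΦc he).1
    obtain ⟨f, hf, w, hw, hxw⟩ := hΦ'.exists_two_nsmul_eq_zero (y := x) hτ (hodd Φ' hΦc')
      fun f hf => mem_edgeKer.1 hx f
        (Finset.mem_erase.2 ⟨fun h => he' (h ▸ hf), (hΦc' hf).1⟩)
    have hxw : x w = 0 := by simpa using hxw
    have hzero : ∀ z, G.Incident z e → x z = 0 := by
      intro z hz
      refine eq_zero_of_reachable hτ hx (hΦ.reachable_erase (fun g hg => (hΦc hg).1) he ?_) hxw
      have h1 := mem_supp_of_incident (hΦc' hf) hw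
      have h2 := mem_supp_of_incident (hΦc he) hz
      rw [SimpleGraph.ConnectedComponent.mem_supp_iff] at h1 h2
      rw [← h2, SimpleGraph.ConnectedComponent.eq] at h1
      exact h1
    apply hxe
    rcases G.edge_cases e with ⟨a, b, s, h⟩ | ⟨v, h⟩ | ⟨v, h⟩
    · rw [h.edgeHom_apply, hzero a (h.incident_iff.2 (Or.inl rfl)),
        hzero b (h.incident_iff.2 (Or.inr rfl))]
      simp
    · rw [h.edgeHom_eq_zero_iff, hzero v (h.incident_iff.2 rfl), smul_zero]
    · rw [h.edgeHom_eq_zero_iff, hzero v (h.incident_iff.2 rfl)]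
  exact fun Φ Φ' h1 h2 h3 h4 => (key Φ Φ' h1 h2 h3 h4).antisymm (key Φ' Φ h2 h1 h4 h3)

theorem isPseudoForest_iff_isIndep (hτ : G.IsOrientation τ) {F : Finset E} :
    G.IsPseudoForest F ↔ G.IsIndep τ F :=
  ⟨fun h => h.isIndep hτ, fun h => h.isPseudoForest hτ⟩

section Bases

theorem IsIndep.insert {F : Finset E} (hF : G.IsIndep τ F) {z : V → ℝ}
    (hz : z ∈ G.edgeKer ℝ τ F) {e : E} (he : G.edgeHom τ e z ≠ 0) :
    G.IsIndep τ (insert e F) := by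
  have heF : e ∉ F := fun h => he (mem_edgeKer.1 hz e h)
  intro f hf
  rcases Finset.mem_insert.1 hf with rfl | hf
  · exact ⟨z, by rwa [Finset.erase_insert heF], he⟩
  obtain ⟨x, hx, hxf⟩ := hF f hf
  have hsmul : ∀ (g : E) (c : ℝ) (y : V → ℝ), G.edgeHom τ g (c • y) = c * G.edgeHom τ g y :=
    fun g c y => edgeHom_comp (AddMonoidHom.mulLeft c) y
  -- The multiple of `z` cancels the product with column `e`, and does not change the product with
  -- column `f`, to which `z` is orthogonal.
  refine ⟨G.edgeHom τ e z • x - G.edgeHom τ e x • z, mem_edgeKer.2 fun g hg => ?_, ?_⟩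
  · rw [map_sub, hsmul, hsmul]
    obtain ⟨hgf, hg⟩ := Finset.mem_erase.1 hg
    rcases Finset.mem_insert.1 hg with rfl | hg
    · ring
    · rw [mem_edgeKer.1 hz g hg, mem_edgeKer.1 hx g (Finset.mem_erase.2 ⟨hgf, hg⟩)]
      ring
  · rw [map_sub, hsmul, hsmul, mem_edgeKer.1 hz f hf, mul_zero, sub_zero]
    exact mul_ne_zero he hxf

theorem IsIndep.eq_of_subset {F F' : Finset E} (hF' : G.IsIndep τ F')
    (h0 : G.edgeKer ℝ τ F = ⊥) (h : F ⊆ F') : F = F' := by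
  refine h.antisymm fun e he => ?_
  by_contra heF
  obtain ⟨x, hx, hxe⟩ := hF' e he
  have := edgeKer_anti (fun f hf => Finset.mem_erase.2 ⟨by rintro rfl; exact heF hf, h hf⟩) hx
  rw [h0, AddSubgroup.mem_bot] at this
  rw [this, map_zero] at hxe
  exact hxe rfl

/-- An independent subset of `S` can be extended to one with the same span as `S`, if `S` has full
row rank. -/
theorem IsIndep.exists_superset {F S : Finset E} (hF : G.IsIndep τ F) (hFS : F ⊆ S)
    (hS : G.edgeKer ℝ τ S = ⊥) :
    ∃ F', F ⊆ F' ∧ F' ⊆ S ∧ G.IsIndep τ F' ∧ G.edgeKer ℝ τ F' = ⊥ := by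
  classical
  obtain ⟨F', ⟨hF', hmax⟩⟩ := Finset.exists_maximal
    (s := S.powerset.filter fun F' => F ⊆ F' ∧ G.IsIndep τ F')
    ⟨F, by simp [hF, hFS]⟩
  simp only [Finset.mem_filter, Finset.mem_powerset] at hF' hmax
  obtain ⟨hS', hFF', hind⟩ := hF'
  refine ⟨F', hFF', hS', hind, ?_⟩
  rw [eq_bot_iff]
  intro z hz
  by_contra hz0
  have : ¬ ∀ e ∈ S, G.edgeHom τ e z = 0 := fun h => by
    have := mem_edgeKer.2 h
    rw [hS] at this
    exact hz0 this
  push Not at this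
  obtain ⟨e, heS, he⟩ := this
  have := hmax ⟨Finset.insert_subset heS hS', hFF'.trans (Finset.subset_insert e F'),
    hind.insert hz he⟩ (Finset.subset_insert e F')
  exact he (mem_edgeKer.1 hz e (this (Finset.mem_insert_self e F')))

theorem isBasis_iff [Fintype E] (hτ : G.IsOrientation τ) (h0 : G.edgeKer ℝ τ Finset.univ = ⊥)
    {F : Finset E} : G.IsBasis F ↔ G.IsIndep τ F ∧ G.edgeKer ℝ τ F = ⊥ := by
  constructor
  · rintro ⟨hF, hmax⟩
    rw [isPseudoForest_iff_isIndep hτ] at hF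
    obtain ⟨F', hFF', -, hind, hker⟩ := hF.exists_superset (Finset.subset_univ F) h0
    have := hmax (hind.isPseudoForest hτ) hFF'
    obtain rfl := hFF'.antisymm this
    exact ⟨hF, hker⟩
  · rintro ⟨hF, hker⟩
    exact ⟨hF.isPseudoForest hτ, fun F' hF' h =>
      (IsIndep.eq_of_subset (hF'.isIndep hτ) hker h).ge⟩

end Bases

end SignedGraph

/-! ### Labellings in ℝ/ℤ and the numbers pc and lc -/

namespace SignedGraph

variable {V E : Type*} {G : SignedGraph V E} {τ : V → E → ℤˣ}

theorem unitAddCircle_two_nsmul_eq_zero_iff {a : UnitAddCircle} :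
    2 • a = 0 ↔ a = 0 ∨ a = ((1 / 2 : ℝ) : UnitAddCircle) := by
  constructor
  · induction a using QuotientAddGroup.induction_on with
    | H r =>
      intro h
      have h : ((2 • r : ℝ) : UnitAddCircle) = 0 := h
      obtain ⟨n, hn⟩ := (AddCircle.coe_eq_zero_iff (1 : ℝ)).1 h
      have hr : r = n / 2 := by
        simp only [zsmul_eq_mul, mul_one, nsmul_eq_mul, Nat.cast_ofNat] at hn
        linarith
      rcases Int.even_or_odd' n with ⟨m, rfl | rfl⟩
      · left
        exact (AddCircle.coe_eq_zero_iff (1 : ℝ)).2 ⟨m, by rw [hr]; push_cast; simp⟩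
      · right
        rw [← sub_eq_zero]
        exact (AddCircle.coe_eq_zero_iff (1 : ℝ)).2 ⟨m, by rw [hr]; push_cast; simp; ring⟩
  · rintro (rfl | rfl)
    · exact smul_zero _
    · exact (AddCircle.coe_eq_zero_iff (1 : ℝ)).2 ⟨1, by norm_num⟩

theorem unitAddCircle_half_ne_zero : ((1 / 2 : ℝ) : UnitAddCircle) ≠ 0 := by
  intro h
  obtain ⟨n, hn⟩ := (AddCircle.coe_eq_zero_iff (1 : ℝ)).1 h
  simp only [zsmul_eq_mul, mul_one] at hn
  have : (2 * n : ℝ) = 1 := by linarith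
  have : 2 * n = 1 := by exact_mod_cast this
  omega

theorem card_unitAddCircle_two_torsion : Nat.card {a : UnitAddCircle // 2 • a = 0} = 2 := by
  have : {a : UnitAddCircle | 2 • a = 0} = {0, ((1 / 2 : ℝ) : UnitAddCircle)} := by
    ext a
    exact unitAddCircle_two_nsmul_eq_zero_iff
  change {a : UnitAddCircle | 2 • a = 0}.ncard = 2
  rw [this, Set.ncard_pair unitAddCircle_half_ne_zero.symm]

theorem unitAddCircle_eq_of_two_torsion {a b : UnitAddCircle} (ha : 2 • a = 0) (hb : 2 • b = 0)
    (h : a ≠ 0 ↔ b ≠ 0) : a = b := by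
  rcases unitAddCircle_two_nsmul_eq_zero_iff.1 ha with rfl | rfl <;>
    rcases unitAddCircle_two_nsmul_eq_zero_iff.1 hb with rfl | rfl
  · rfl
  · exact absurd rfl (h.2 unitAddCircle_half_ne_zero)
  · exact absurd rfl (h.1 unitAddCircle_half_ne_zero)
  · rfl

/-- The components of `(V, S)` without halfedge. -/
def HalfedgeFreeComp (G : SignedGraph V E) (S : Finset E) : Type _ :=
  {c : (G.linkGraph S).ConnectedComponent // ∀ e ∈ G.compEdges S c, ¬ G.IsHalfedge e}

/-- Signs act trivially on 2-torsion, so labels are constant on components; a halfedge makes them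
zero and a loop imposes nothing. Each halfedge-free component thus has a free choice from {0, 1/2}.
-/
theorem card_edgeKer [Finite V] (hτ : G.IsOrientation τ) {S : Finset E}
    (h2 : ∀ y ∈ G.edgeKer UnitAddCircle τ S, ∀ v, 2 • y v = 0) :
    Nat.card (G.edgeKer UnitAddCircle τ S) = 2 ^ Nat.card (G.HalfedgeFreeComp S) := by
  classical
  have : Finite (G.HalfedgeFreeComp S) := by unfold HalfedgeFreeComp; infer_instance
  rw [← card_unitAddCircle_two_torsion, ← Nat.card_fun]
  have hout : ∀ c : (G.linkGraph S).ConnectedComponent,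
      (G.linkGraph S).connectedComponentMk (Quot.out c) = c := fun c => Quot.out_eq c
  refine Nat.card_congr (Equiv.ofBijective
    (fun y c => (⟨y.1 (Quot.out c.1), h2 y.1 y.2 _⟩ : {a : UnitAddCircle // 2 • a = 0})) ⟨?_, ?_⟩)
  · rintro ⟨y, hy⟩ ⟨z, hz⟩ hyz
    refine Subtype.ext (funext fun v => ?_)
    set c := (G.linkGraph S).connectedComponentMk v with hc
    have hr : (G.linkGraph S).Reachable (Quot.out c) v :=
      SimpleGraph.ConnectedComponent.eq.1 (hout c)
    by_cases h : ∀ e ∈ G.compEdges S c, ¬ G.IsHalfedge e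
    · have := congrArg Subtype.val (congrFun hyz ⟨c, h⟩)
      change y v = z v
      rw [eq_of_reachable hτ hy (h2 y hy) hr, eq_of_reachable hτ hz (h2 z hz) hr]
      exact this
    · push Not at h
      obtain ⟨e, he, w, hw⟩ := h
      have hwv : (G.linkGraph S).Reachable w v :=
        mem_supp_mk.1 (mem_supp_of_incident he (hw.incident_iff.2 rfl))
      change y v = z v
      rw [eq_zero_of_reachable hτ hy hwv ((hw.edgeHom_eq_zero_iff y).1 (mem_edgeKer.1 hy e he.1)),
        eq_zero_of_reachable hτ hz hwv ((hw.edgeHom_eq_zero_iff z).1 (mem_edgeKer.1 hz e he.1))]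
  · intro g
    let y : V → UnitAddCircle := fun v =>
      if h : ∀ e ∈ G.compEdges S ((G.linkGraph S).connectedComponentMk v), ¬ G.IsHalfedge e
      then (g ⟨_, h⟩).1 else 0
    have hy2 : ∀ v, 2 • y v = 0 := fun v => by
      by_cases h : ∀ e ∈ G.compEdges S ((G.linkGraph S).connectedComponentMk v), ¬ G.IsHalfedge e
      · simp only [y, dif_pos h]
        exact (g ⟨_, h⟩).2
      · simp only [y, dif_neg h, smul_zero]
    have hyeq : ∀ u v, (G.linkGraph S).connectedComponentMk u =
        (G.linkGraph S).connectedComponentMk v → y u = y v := fun u v h => by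
      simp only [y, h]
    have hy : y ∈ G.edgeKer UnitAddCircle τ S := by
      refine mem_edgeKer.2 fun e he => ?_
      rcases G.edge_cases e with ⟨u, v, s, h⟩ | ⟨v, h⟩ | ⟨v, h⟩
      · rw [h.edgeHom_eq_zero_iff hτ, units_smul_of_two_nsmul (hy2 u)]
        exact hyeq _ _ (SimpleGraph.ConnectedComponent.eq.2 (h.adj he).reachable.symm)
      · rw [h.edgeHom_eq_zero_iff, hy2]
      · rw [h.edgeHom_eq_zero_iff]
        refine dif_neg fun hno => hno e ⟨he, v, ?_, h.incident_iff.2 rfl⟩ ⟨v, h⟩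
        exact mem_supp_mk.2 (SimpleGraph.Reachable.refl v)
    refine ⟨⟨y, hy⟩, funext fun c => Subtype.ext ?_⟩
    have h : ∀ e ∈ G.compEdges S ((G.linkGraph S).connectedComponentMk (Quot.out c.1)),
        ¬ G.IsHalfedge e := by
      rw [hout]
      exact c.2
    change y (Quot.out c.1) = _
    simp only [y, dif_pos h]
    congr 2
    exact Subtype.ext (hout c.1)

theorem not_isTreeComp (hτ : G.IsOrientation τ) {F : Finset E} (h0 : G.edgeKer ℝ τ F = ⊥)
    (c : (G.linkGraph F).ConnectedComponent) : ¬ G.IsTreeComp F c := by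
  rw [isTreeComp_iff]
  intro hno
  obtain ⟨x, hx, hxc⟩ := exists_mem_edgeKer (G := G) hτ (F := F) (K := c.supp)
    (fun e he u v s hl hu => mem_supp_of_isLink he hl hu) hno
  rw [h0, AddSubgroup.mem_bot] at hx
  obtain ⟨v, hv⟩ := c.nonempty_supp
  exact (hxc v).2 hv (by rw [hx]; rfl)

/-- No component is a tree, since a tree supports a real left kernel vector. So each has a feature,
where 2y = 0 holds at some node, and links spread this to the component. -/
theorem IsPseudoForest.two_nsmul_eq_zero {X : Type*} [AddCommGroup X] (hτ : G.IsOrientation τ)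
    {F : Finset E} (hF : G.IsPseudoForest F) (h0 : G.edgeKer ℝ τ F = ⊥) {y : V → X}
    (hy : y ∈ G.edgeKer X τ F) (v : V) : 2 • y v = 0 := by
  set c := (G.linkGraph F).connectedComponentMk v with hc
  have hno := not_isTreeComp hτ h0 c
  rw [isTreeComp_iff] at hno
  push Not at hno
  obtain ⟨Φ, hΦ, hΦf⟩ := hno
  obtain ⟨e, he, w, hw, hyw⟩ := hΦf.exists_two_nsmul_eq_zero (y := y) hτ
    ((comp_types_iff.1 (hF c)).2 Φ hΦ) fun e he => mem_edgeKer.1 hy e (hΦ he).1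
  exact two_nsmul_eq_zero_of_reachable hτ hy
    (mem_supp_mk.1 (mem_supp_of_incident (hΦ he) hw)) hyw

theorem IsPseudoForest.card_halfedgeFreeComp [Finite V] (hτ : G.IsOrientation τ) {F : Finset E}
    (hF : G.IsPseudoForest F) (h0 : G.edgeKer ℝ τ F = ⊥) :
    Nat.card (G.HalfedgeFreeComp F) = G.pc F + G.lc F := by
  classical
  unfold pc lc HalfedgeFreeComp
  have hdisj : Disjoint (G.IsPseudoTreeComp F) (G.IsLoopTreeComp F) := by
    rw [Pi.disjoint_iff]
    intro c
    rw [Prop.disjoint_iff]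
    rintro ⟨⟨-, h, -⟩, -, ⟨e, he, -⟩, -⟩
    exact h e he.1 he.2
  rw [← Nat.card_sum, ← Nat.card_congr (subtypeOrEquiv _ _ hdisj)]
  refine Nat.card_congr (Equiv.subtypeEquivRight fun c => ?_)
  constructor
  · intro h
    rcases hF c with h' | ⟨-, -, ⟨e, he, -⟩⟩ | h' | h'
    · exact absurd h' (not_isTreeComp hτ h0 c)
    · exact absurd he.2 (h e he.1)
    · exact Or.inr h'
    · exact Or.inl h'
  · rintro (h | h)
    · exact h.2.2
    · exact h.2.2

theorem IsPseudoForest.card_edgeKer [Finite V] (hτ : G.IsOrientation τ) {F : Finset E}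
    (hF : G.IsPseudoForest F) (h0 : G.edgeKer ℝ τ F = ⊥) :
    Nat.card (G.edgeKer UnitAddCircle τ F) = 2 ^ (G.pc F + G.lc F) := by
  rw [← hF.card_halfedgeFreeComp hτ h0,
    SignedGraph.card_edgeKer hτ fun y hy => hF.two_nsmul_eq_zero hτ h0 hy]

variable [DecidableEq E]

/-- `S` contains an independent set that has the same left kernel modulo 2. -/
theorem exists_isIndep_two_torsion (hτ : G.IsOrientation τ) (S : Finset E) :
    ∃ F ⊆ S, G.IsIndep τ F ∧ ∀ y ∈ G.edgeKer UnitAddCircle τ F, (∀ v, 2 • y v = 0) →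
      y ∈ G.edgeKer UnitAddCircle τ S := by
  classical
  obtain ⟨F, ⟨hF, hmin⟩⟩ := Finset.exists_minimal
    (s := S.powerset.filter fun F => ∀ y ∈ G.edgeKer UnitAddCircle τ F, (∀ v, 2 • y v = 0) →
      y ∈ G.edgeKer UnitAddCircle τ S) ⟨S, by simp +contextual⟩
  simp only [Finset.mem_filter, Finset.mem_powerset] at hF hmin
  obtain ⟨hFS, hFker⟩ := hF
  refine ⟨F, hFS, ?_, hFker⟩
  have hex : ∀ e ∈ F, ∃ y ∈ G.edgeKer UnitAddCircle τ (F.erase e), (∀ v, 2 • y v = 0) ∧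
      G.edgeHom τ e y ≠ 0 := by
    intro e he
    by_contra! hcon
    have := hmin (y := F.erase e) ⟨(Finset.erase_subset e F).trans hFS, fun y hy hy2 =>
      hFker y (mem_edgeKer.2 fun f hf => ?_) hy2⟩ (Finset.erase_subset e F) he
    · exact Finset.notMem_erase e F this
    · by_cases hfe : f = e
      · rw [hfe, hcon y hy hy2]
      · exact mem_edgeKer.1 hy f (Finset.mem_erase.2 ⟨hfe, hf⟩)
  -- Loops, and any one edge of a circle given the others, impose nothing on 2-torsion labels. So
  -- the minimal `F` contains no loops and no circles.
  have hloop : ∀ e ∈ F, ¬ G.IsLoop e := by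
    rintro e he ⟨v, h⟩
    obtain ⟨y, -, hy2, hye⟩ := hex e he
    exact hye ((h.edgeHom_eq_zero_iff y).2 (hy2 v))
  have hcirc : ∀ C, G.IsCircle C → ¬ C ⊆ F := by
    intro C hC hCF
    obtain ⟨e, he⟩ := hC.nonempty
    obtain ⟨y, hy, hy2, hye⟩ := hex e (hCF he)
    exact hye (hC.edgeHom_eq_zero hτ he (Or.inr hy2) fun f hf hfe =>
      mem_edgeKer.1 hy f (Finset.mem_erase.2 ⟨hfe, hCF hf⟩))
  intro e he
  obtain ⟨y, hy, hy2, hye⟩ := hex e he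
  have hlink : ∀ f u v s, G.IsLink f u v s → (G.edgeHom τ f y = 0 ↔ y v = y u) :=
    fun f u v s h => by rw [h.edgeHom_eq_zero_iff hτ, units_smul_of_two_nsmul (hy2 u)]
  -- The support of `y` is a union of components of `F.erase e` without halfedges, hence without
  -- features, so it supports a real labelling `x`. A 2-torsion value is determined by whether it
  -- vanishes; therefore `e` is orthogonal to `x` only if it is orthogonal to `y`.
  obtain ⟨x, hx, hxy⟩ := exists_mem_edgeKer (G := G) hτ (F := F.erase e) (K := {v | y v ≠ 0})
    (fun f hf u v s h hu => by
      have := (hlink f u v s h).1 (mem_edgeKer.1 hy f hf)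
      simpa [this] using hu) (by
      rintro Φ hΦ (h | ⟨f, rfl, h | ⟨v, h⟩⟩)
      · exact hcirc Φ h fun f hf => Finset.mem_of_mem_erase (hΦ hf).1
      · exact hloop f (Finset.mem_of_mem_erase (hΦ rfl).1) h
      · obtain ⟨hf, w, hw, hwf⟩ := hΦ rfl
        rw [h.incident_iff.1 hwf] at hw
        exact hw ((h.edgeHom_eq_zero_iff y).1 (mem_edgeKer.1 hy f hf)))
  refine ⟨x, hx, fun h0 => hye ?_⟩
  rcases G.edge_cases e with ⟨u, v, s, h⟩ | h | ⟨v, h⟩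
  · rw [hlink e u v s h]
    refine unitAddCircle_eq_of_two_torsion (hy2 v) (hy2 u) ?_
    have hv := hxy v
    have hu := hxy u
    simp only [Set.mem_ofPred_eq] at hu hv
    rw [← hu, ← hv, (h.edgeHom_eq_zero_iff hτ x).1 h0, not_iff_not, smul_eq_zero_iff_eq]
  · exact absurd h (hloop e he)
  · rw [h.edgeHom_eq_zero_iff] at h0 ⊢
    by_contra hyv
    exact (hxy v).2 hyv h0

variable [Fintype E]

/-- Extend a set that controls the 2-torsion labellings of `S` to a basis. Over a basis every
labelling in ℝ/ℤ is 2-torsion, so it is also orthogonal to `S`. -/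
theorem exists_isBasis_edgeKer_eq (hτ : G.IsOrientation τ)
    {S : Finset E} (hS : G.edgeKer ℝ τ S = ⊥) :
    ∃ F ⊆ S, G.IsBasis F ∧ G.edgeKer UnitAddCircle τ F = G.edgeKer UnitAddCircle τ S := by
  have h0 : G.edgeKer ℝ τ Finset.univ = ⊥ :=
    eq_bot_iff.2 (hS ▸ edgeKer_anti (Finset.subset_univ S))
  obtain ⟨F₁, hF₁S, hind₁, hF₁⟩ := exists_isIndep_two_torsion hτ S
  obtain ⟨F, hF₁F, hFS, hind, hker⟩ := hind₁.exists_superset hF₁S hS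
  refine ⟨F, hFS, (isBasis_iff hτ h0).2 ⟨hind, hker⟩, le_antisymm (fun y hy => ?_)
    (edgeKer_anti hFS)⟩
  exact hF₁ y (edgeKer_anti hF₁F hy)
    ((hind.isPseudoForest hτ).two_nsmul_eq_zero hτ hker hy)

theorem isSpanning_iff (hτ : G.IsOrientation τ) (h0 : G.edgeKer ℝ τ Finset.univ = ⊥)
    {S : Finset E} : G.IsSpanning S ↔ G.edgeKer ℝ τ S = ⊥ := by
  constructor
  · rintro ⟨F, hFS, hF⟩
    exact eq_bot_iff.2 (((isBasis_iff hτ h0).1 hF).2 ▸ edgeKer_anti hFS)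
  · intro hS
    obtain ⟨F, hFS, hF, -⟩ := exists_isBasis_edgeKer_eq hτ hS
    exact ⟨F, hFS, hF⟩

/-- Every basis in `S` has a kernel containing that of `S`, and one of them has the same kernel; so
the smallest exponent is the right one. -/
theorem card_edgeKer_eq_two_pow_minPcLc [Finite V] (hτ : G.IsOrientation τ) {S : Finset E}
    (hS : G.edgeKer ℝ τ S = ⊥) :
    Nat.card (G.edgeKer UnitAddCircle τ S) = 2 ^ G.minPcLc S := by
  have h0 : G.edgeKer ℝ τ Finset.univ = ⊥ :=
    eq_bot_iff.2 (hS ▸ edgeKer_anti (Finset.subset_univ S))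
  have hcard : ∀ F, G.IsBasis F →
      Nat.card (G.edgeKer UnitAddCircle τ F) = 2 ^ (G.pc F + G.lc F) := fun F hF =>
    hF.1.card_edgeKer hτ ((isBasis_iff hτ h0).1 hF).2
  obtain ⟨F, hFS, hF, hker⟩ := exists_isBasis_edgeKer_eq hτ hS
  rw [← hker, hcard F hF]
  congr 1
  refine le_antisymm (le_csInf ⟨_, F, hFS, hF, rfl⟩ ?_) (Nat.sInf_le ⟨F, hFS, hF, rfl⟩)
  rintro _ ⟨F', hF'S, hF', rfl⟩
  rw [← Nat.pow_le_pow_iff_right (a := 2) (by norm_num), ← hcard F hF, ← hcard F' hF', hker]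
  have : Finite (G.edgeKer UnitAddCircle τ F') :=
    Nat.finite_of_card_ne_zero (by rw [hcard F' hF']; positivity)
  exact Nat.card_le_card_of_injective _
    (AddSubgroup.inclusion_injective (edgeKer_anti (τ := τ) (X := UnitAddCircle) hF'S))

theorem card_edgeKer_of_connectedOn [Finite V] (hτ : G.IsOrientation τ) {S : Finset E}
    (hS : G.edgeKer ℝ τ S = ⊥) (hconn : G.ConnectedOn S) :
    ((∃ e ∈ S, G.IsHalfedge e) → Nat.card (G.edgeKer UnitAddCircle τ S) = 1) ∧
    ((¬ ∃ e ∈ S, G.IsHalfedge e) → Nat.card (G.edgeKer UnitAddCircle τ S) = 2) := by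
  have h2 : ∀ y ∈ G.edgeKer UnitAddCircle τ S, ∀ v, 2 • y v = 0 := by
    intro y hy
    obtain ⟨F, hFS, hF, hker⟩ := exists_isBasis_edgeKer_eq hτ hS
    have h0 : G.edgeKer ℝ τ Finset.univ = ⊥ :=
      eq_bot_iff.2 (hS ▸ edgeKer_anti (Finset.subset_univ S))
    rw [← hker] at hy
    exact hF.1.two_nsmul_eq_zero hτ ((isBasis_iff hτ h0).1 hF).2 hy
  have hsub : Subsingleton (G.linkGraph S).ConnectedComponent :=
    hconn.preconnected.subsingleton_connectedComponent
  rw [card_edgeKer hτ h2]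
  constructor
  · rintro ⟨e, he, v, h⟩
    have : IsEmpty (G.HalfedgeFreeComp S) := ⟨fun c => c.2 e ⟨he, v, by
      rw [SimpleGraph.ConnectedComponent.mem_supp_iff]
      exact Subsingleton.elim _ _, h.incident_iff.2 rfl⟩ ⟨v, h⟩⟩
    rw [Nat.card_of_isEmpty, pow_zero]
  · intro h
    push Not at h
    obtain ⟨v⟩ := hconn.nonempty
    have : Nat.card (G.HalfedgeFreeComp S) = 1 := by
      rw [Nat.card_eq_one_iff_unique]
      exact ⟨⟨fun a b => Subtype.ext (Subsingleton.elim _ _)⟩,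
        ⟨(G.linkGraph S).connectedComponentMk v, fun e he => h e he.1⟩⟩
    rw [this, pow_one]

end SignedGraph

/-! ### The integer lattice modulo the row space -/

/-- The vectors with integer entries. -/
def integerVectors (E : Type*) : AddSubgroup (E → ℝ) where
  carrier := {z | ∀ e, ∃ k : ℤ, z e = k}
  zero_mem' _ := ⟨0, by simp⟩
  add_mem' hx hy e := by
    obtain ⟨k, hk⟩ := hx e
    obtain ⟨l, hl⟩ := hy e
    exact ⟨k + l, by simp [hk, hl]⟩
  neg_mem' hx e := by
    obtain ⟨k, hk⟩ := hx e
    exact ⟨-k, by simp [hk]⟩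

theorem mem_integerVectors {E : Type*} {z : E → ℝ} :
    z ∈ integerVectors E ↔ ∀ e, ∃ k : ℤ, z e = k := Iff.rfl

theorem sum_smul_single {E : Type*} [DecidableEq E] (I : Finset E) (c : E → ℝ) :
    ∑ i ∈ I, c i • (Pi.single i 1 : E → ℝ) = fun e => if e ∈ I then c e else 0 := by
  ext e
  simp [Finset.sum_apply, Pi.single_apply]

theorem mem_span_single_iff {E : Type*} [DecidableEq E] {I : Finset E} {z : E → ℝ} :
    z ∈ Submodule.span ℝ ((fun i => (Pi.single i 1 : E → ℝ)) '' I) ↔ ∀ e, e ∉ I → z e = 0 := by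
  constructor
  · intro h e he
    obtain ⟨c, rfl⟩ := exists_sum_of_mem_span_image h
    rw [sum_smul_single]
    simp [he]
  · intro h
    have : z = ∑ i ∈ I, z i • (Pi.single i 1 : E → ℝ) := by
      rw [sum_smul_single]
      ext e
      by_cases he : e ∈ I
      · simp [he]
      · simp [he, h e he]
    rw [this]
    exact Submodule.sum_mem _ fun i hi =>
      Submodule.smul_mem _ _ (Submodule.subset_span ⟨i, hi, rfl⟩)

theorem mem_closure_single_iff {E : Type*} [DecidableEq E] {I : Finset E} {z : E → ℝ} :
    z ∈ AddSubgroup.closure ((fun i => (Pi.single i 1 : E → ℝ)) '' I) ↔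
      z ∈ integerVectors E ∧ ∀ e, e ∉ I → z e = 0 := by
  constructor
  · intro h
    refine ⟨?_, mem_span_single_iff.1 (closure_image_le_span I h)⟩
    refine (AddSubgroup.closure_le _).2 ?_ h
    rintro _ ⟨i, -, rfl⟩ e
    by_cases he : e = i
    · subst he
      exact ⟨1, by simp⟩
    · exact ⟨0, by simp [he]⟩
  · rintro ⟨hz, h⟩
    choose k hk using hz
    have : z = ∑ i ∈ I, k i • (Pi.single i 1 : E → ℝ) := by
      simp only [← Int.cast_smul_eq_zsmul ℝ]
      rw [sum_smul_single I fun i => (k i : ℝ)]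
      ext e
      by_cases he : e ∈ I
      · simp [he, hk]
      · simp [he, h e he]
    rw [this]
    exact AddSubgroup.sum_mem _ fun i hi =>
      AddSubgroup.zsmul_mem _ (AddSubgroup.subset_closure (Set.mem_image_of_mem _ hi)) _

namespace SignedGraph

variable {V E : Type*} {G : SignedGraph V E} {τ : V → E → ℤˣ}

/-- The node vectors whose products with the columns in `S` are integers. -/
def integralDual (G : SignedGraph V E) (τ : V → E → ℤˣ) (S : Finset E) : AddSubgroup (V → ℝ) :=
  (G.edgeKer UnitAddCircle τ S).comap
    ((QuotientAddGroup.mk' (AddSubgroup.zmultiples (1 : ℝ))).compLeft V)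

theorem mem_integralDual {S : Finset E} {x : V → ℝ} :
    x ∈ G.integralDual τ S ↔ ∀ e ∈ S, ∃ k : ℤ, G.edgeHom τ e x = k := by
  rw [integralDual, AddSubgroup.mem_comap, mem_edgeKer]
  refine forall₂_congr fun e _ => ?_
  have : G.edgeHom τ e ((QuotientAddGroup.mk' (AddSubgroup.zmultiples (1 : ℝ))).compLeft V x) =
      ((G.edgeHom τ e x : ℝ) : UnitAddCircle) :=
    edgeHom_comp (QuotientAddGroup.mk' (AddSubgroup.zmultiples (1 : ℝ))) x
  refine Eq.congr_left this |>.trans ((AddCircle.coe_eq_zero_iff (1 : ℝ)).trans ?_)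
  simp [eq_comm]

theorem relIndex_integralDual (S S' : Finset E) :
    (G.integralDual τ S).relIndex (G.integralDual τ S') =
      (G.edgeKer UnitAddCircle τ S).relIndex (G.edgeKer UnitAddCircle τ S') := by
  rw [integralDual, AddSubgroup.relIndex_comap, integralDual,
    AddSubgroup.map_comap_eq_self_of_surjective]
  intro y
  choose x hx using fun v => QuotientAddGroup.mk'_surjective (AddSubgroup.zmultiples (1 : ℝ)) (y v)
  exact ⟨x, funext hx⟩

variable [Fintype V] [DecidableEq V]

/-- The row space of the incidence matrix. -/
noncomputable def rowSpace (G : SignedGraph V E) (τ : V → E → ℤˣ) : Submodule ℝ (E → ℝ) :=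
  LinearMap.range (G.incidenceMatrix τ).vecMulLinear

theorem mem_rowSpace {z : E → ℝ} :
    z ∈ G.rowSpace τ ↔ ∃ x : V → ℝ, ∀ e, z e = G.edgeHom τ e x := by
  simp only [rowSpace, LinearMap.mem_range, Matrix.vecMulLinear_apply, funext_iff,
    vecMul_incidenceMatrix, eq_comm]

variable [Fintype E]

theorem edgeKer_univ_eq_bot (hrank : (G.incidenceMatrix τ).rank = Fintype.card V) :
    G.edgeKer ℝ τ Finset.univ = ⊥ := by
  have htop : LinearMap.range (G.incidenceMatrix τ).mulVecLin = ⊤ :=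
    Submodule.eq_top_of_finrank_eq (by
      rw [Module.finrank_fintype_fun_eq_card]
      exact hrank)
  rw [eq_bot_iff]
  intro x hx
  have hx0 : Matrix.vecMul x (G.incidenceMatrix τ) = 0 := funext fun e => by
    rw [vecMul_incidenceMatrix]
    exact mem_edgeKer.1 hx e (Finset.mem_univ e)
  -- The columns span, so x = A w; as x is orthogonal to all columns, x · x = 0.
  obtain ⟨w, hw⟩ := LinearMap.range_eq_top.1 htop x
  rw [Matrix.mulVecLin_apply] at hw
  rw [AddSubgroup.mem_bot, ← dotProduct_self_eq_zero]
  nth_rewrite 2 [← hw]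
  rw [Matrix.dotProduct_mulVec, hx0, zero_dotProduct]

variable [DecidableEq E]

/-- A vector of the row space that is supported on `I` is xᵀA with x orthogonal to all columns
outside `I`. -/
theorem indepMod_rowSpace_iff (h0 : G.edgeKer ℝ τ Finset.univ = ⊥) {I : Finset E} :
    IndepMod (G.rowSpace τ) (fun i => (Pi.single i 1 : E → ℝ)) I ↔ G.edgeKer ℝ τ Iᶜ = ⊥ := by
  unfold IndepMod
  simp only [sum_smul_single]
  constructor
  · intro h
    refine eq_bot_iff.2 fun x hx => ?_
    have hI := h (fun e => G.edgeHom τ e x) (mem_rowSpace.2 ⟨x, fun e => by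
      split_ifs with he
      · rfl
      · exact (mem_edgeKer.1 hx e (by simpa using he)).symm⟩)
    rw [← h0]
    refine mem_edgeKer.2 fun e _ => ?_
    by_cases he : e ∈ I
    · exact hI e he
    · exact mem_edgeKer.1 hx e (by simpa using he)
  · intro h c hc i hi
    obtain ⟨x, hx⟩ := mem_rowSpace.1 hc
    have hx0 : x ∈ G.edgeKer ℝ τ Iᶜ := mem_edgeKer.2 fun e he => by
      rw [← hx e, if_neg (by simpa using he)]
    rw [h, AddSubgroup.mem_bot] at hx0
    have := hx i
    rwa [if_pos hi, hx0, map_zero] at this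

/-- Outside `I`, an integer vector of U + ℝ^I agrees with xᵀA for a unique x (by `hI`), whose
products with the columns outside `I` are integers. It lies in the subgroup exactly when x has
integer products with all columns. So the quotient is that of the two integral duals, which reduces
modulo 1 to the kernels. -/
theorem latticeIndex_rowSpace {I : Finset E} (hI : G.edgeKer ℝ τ Iᶜ = ⊥) :
    latticeIndex (integerVectors E) (G.rowSpace τ) (fun i => (Pi.single i 1 : E → ℝ)) I =
      (G.edgeKer UnitAddCircle τ Finset.univ).relIndex (G.edgeKer UnitAddCircle τ Iᶜ) := by
  rw [← relIndex_integralDual, latticeIndex]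
  set H := AddSubgroup.closure ((fun i => (Pi.single i 1 : E → ℝ)) '' I) ⊔
    (integerVectors E ⊓ (G.rowSpace τ).toAddSubgroup) with hHdef
  have hH : ∀ z, z ∈ H ↔ z ∈ integerVectors E ∧
      ∃ x ∈ G.integralDual τ Finset.univ, ∀ e, e ∉ I → z e = G.edgeHom τ e x := by
    intro z
    rw [hHdef, AddSubgroup.mem_sup]
    constructor
    · rintro ⟨a, ha, b, ⟨hb, hbU⟩, rfl⟩
      obtain ⟨ha, haI⟩ := mem_closure_single_iff.1 ha
      obtain ⟨x, hx⟩ := mem_rowSpace.1 hbU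
      refine ⟨add_mem ha hb, x, mem_integralDual.2 fun e _ => ?_, fun e he => ?_⟩
      · rw [← hx e]
        exact hb e
      · rw [Pi.add_apply, haI e he, zero_add, hx e]
    · rintro ⟨hz, x, hx, hzx⟩
      have hxL : (fun e => G.edgeHom τ e x) ∈ integerVectors E := fun e =>
        mem_integralDual.1 hx e (Finset.mem_univ e)
      refine ⟨z - fun e => G.edgeHom τ e x, mem_closure_single_iff.2 ⟨sub_mem hz hxL,
        fun e he => ?_⟩, fun e => G.edgeHom τ e x,
        ⟨hxL, mem_rowSpace.2 ⟨x, fun _ => rfl⟩⟩, sub_add_cancel _ _⟩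
      rw [Pi.sub_apply, hzx e he, sub_self]
  -- Entries in `I` are irrelevant modulo the unit vectors of `I`; zero keeps the vector integral.
  let h : (V → ℝ) →+ (E → ℝ) :=
    { toFun := fun x e => if e ∈ I then 0 else G.edgeHom τ e x
      map_zero' := by ext; simp
      map_add' := fun x y => by ext e; by_cases he : e ∈ I <;> simp [he] }
  have hcompl : ∀ e, e ∉ I → e ∈ Iᶜ := fun e he => Finset.mem_compl.2 he
  have hhL : ∀ x ∈ G.integralDual τ Iᶜ, h x ∈ integerVectors E := by
    intro x hx e
    by_cases he : e ∈ I
    · exact ⟨0, by simp [h, he]⟩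
    · obtain ⟨k, hk⟩ := mem_integralDual.1 hx e (hcompl e he)
      exact ⟨k, by simp [h, he, hk]⟩
  have hX : integerVectors E ⊓ (G.rowSpace τ ⊔
      Submodule.span ℝ ((fun i => (Pi.single i 1 : E → ℝ)) '' I)).toAddSubgroup =
      (G.integralDual τ Iᶜ).map h ⊔ H := by
    apply le_antisymm
    · rintro z ⟨hz, hzU⟩
      obtain ⟨a, ha, b, hb, rfl⟩ := Submodule.mem_sup.1 hzU
      obtain ⟨x, hx⟩ := mem_rowSpace.1 ha
      have hb := mem_span_single_iff.1 hb
      have hzx : ∀ e, e ∉ I → (a + b) e = G.edgeHom τ e x := fun e he => by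
        rw [Pi.add_apply, hb e he, add_zero, hx e]
      have hxM : x ∈ G.integralDual τ Iᶜ := mem_integralDual.2 fun e he => by
        rw [← hzx e (Finset.mem_compl.1 he)]
        exact hz e
      refine AddSubgroup.mem_sup.2 ⟨h x, ⟨x, hxM, rfl⟩, a + b - h x, ?_, add_sub_cancel _ _⟩
      refine AddSubgroup.mem_sup_left (mem_closure_single_iff.2
        ⟨sub_mem hz (hhL x hxM), fun e he => ?_⟩)
      rw [Pi.sub_apply, hzx e he]
      simp [h, he]
    · have hmem : ∀ z x, (∀ e, e ∉ I → z e = G.edgeHom τ e x) → z ∈ (G.rowSpace τ ⊔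
          Submodule.span ℝ ((fun i => (Pi.single i 1 : E → ℝ)) '' I)) := by
        intro z x hzx
        refine Submodule.mem_sup.2 ⟨fun e => G.edgeHom τ e x, mem_rowSpace.2 ⟨x, fun _ => rfl⟩,
          z - fun e => G.edgeHom τ e x, mem_span_single_iff.2 fun e he => ?_, add_sub_cancel _ _⟩
        rw [Pi.sub_apply, hzx e he, sub_self]
      refine sup_le ?_ fun z hz => ?_
      · rintro _ ⟨x, hx, rfl⟩
        exact ⟨hhL x hx, hmem _ x fun e he => by simp [h, he]⟩
      · obtain ⟨hzL, x, -, hzx⟩ := (hH z).1 hz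
        exact ⟨hzL, hmem z x hzx⟩
  rw [hX, AddSubgroup.relIndex_sup_right, ← AddSubgroup.relIndex_comap,
    ← AddSubgroup.inf_relIndex_right]
  congr 1
  ext x
  rw [AddSubgroup.mem_inf, AddSubgroup.mem_comap, hH]
  constructor
  · rintro ⟨⟨-, x', hx', hxx'⟩, hx⟩
    have : x - x' ∈ G.edgeKer ℝ τ Iᶜ := mem_edgeKer.2 fun e he => by
      have he := Finset.mem_compl.1 he
      have := hxx' e he
      simp only [h, AddMonoidHom.coe_mk, ZeroHom.coe_mk, if_neg he] at this
      rw [map_sub, this, sub_self]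
    rw [hI, AddSubgroup.mem_bot, sub_eq_zero] at this
    rwa [this]
  · intro hx
    have hxI : x ∈ G.integralDual τ Iᶜ :=
      mem_integralDual.2 fun e _ => mem_integralDual.1 hx e (Finset.mem_univ e)
    exact ⟨⟨hhL x hxI, x, hx, fun e he => by simp [h, he]⟩, hxI⟩

end SignedGraph

/-! ### The binet matrix and the lattice points of the tocyclotope -/

namespace SignedGraph

variable {V E : Type*} [Fintype V] [DecidableEq V]
  {G : SignedGraph V E} {τ : V → E → ℤˣ}

section Binet

variable {T : Finset E} {φ : V ≃ {e // e ∈ T}}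

theorem isUnit_basisMatrix (hT : G.edgeKer ℝ τ T = ⊥) :
    IsUnit (basisMatrix (G.incidenceMatrix τ) T φ) := by
  rw [← Matrix.vecMul_injective_iff_isUnit]
  intro x y hxy
  have : x - y ∈ G.edgeKer ℝ τ T := mem_edgeKer.2 fun e he => by
    have := congrFun hxy (φ.symm ⟨e, he⟩)
    have hcol : ∀ z : V → ℝ, Matrix.vecMul z (basisMatrix (G.incidenceMatrix τ) T φ)
        (φ.symm ⟨e, he⟩) = G.edgeHom τ e z := fun z => by
      rw [← vecMul_incidenceMatrix]
      simp [basisMatrix, Matrix.vecMul, dotProduct]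
    rw [map_sub, ← hcol, ← hcol, sub_eq_zero]
    exact this
  rw [hT, AddSubgroup.mem_bot] at this
  exact sub_eq_zero.1 this

theorem vecMul_basisMatrix (x : V → ℝ) (v : V) :
    Matrix.vecMul x (basisMatrix (G.incidenceMatrix τ) T φ) v = G.edgeHom τ (φ v) x := by
  rw [← vecMul_incidenceMatrix]
  rfl

theorem vecMul_restMatrix (x : V → ℝ) (r : {e // e ∉ T}) :
    Matrix.vecMul x (restMatrix (G.incidenceMatrix τ) T) r = G.edgeHom τ r x := by
  rw [← vecMul_incidenceMatrix]
  rfl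

/-- The linear map of the matrix `[I | -Bᵀ]` with the columns indexed by `E`. -/
noncomputable def dualMap (A : Matrix V E ℝ) (T : Finset E) (φ : V ≃ {e // e ∈ T}) :
    (E → ℝ) →ₗ[ℝ] ({e // e ∉ T} → ℝ) :=
  LinearMap.funLeft ℝ ℝ Subtype.val -
    (binetMatrix A T φ).vecMulLinear ∘ₗ LinearMap.funLeft ℝ ℝ (fun v => (φ v : E))

theorem dualMap_apply (A : Matrix V E ℝ) (x : E → ℝ) (r : {e // e ∉ T}) :
    dualMap A T φ x r = x r - Matrix.vecMul (fun v => x (φ v)) (binetMatrix A T φ) r := rfl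

/-- With y = x_T T⁻¹, the kernel condition x_R = x_T T⁻¹R says that x = yᵀA. -/
theorem ker_dualMap (hT : G.edgeKer ℝ τ T = ⊥) :
    LinearMap.ker (dualMap (G.incidenceMatrix τ) T φ) = G.rowSpace τ := by
  have hunit := (Matrix.isUnit_iff_isUnit_det _).1 (isUnit_basisMatrix (φ := φ) hT)
  have key : ∀ (x : E → ℝ), dualMap (G.incidenceMatrix τ) T φ x = 0 ↔
      ∀ r : {e // e ∉ T}, x r = Matrix.vecMul (Matrix.vecMul (fun v => x (φ v))
        (basisMatrix (G.incidenceMatrix τ) T φ)⁻¹) (restMatrix (G.incidenceMatrix τ) T) r := by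
    intro x
    simp only [funext_iff, dualMap_apply, Pi.zero_apply, sub_eq_zero, binetMatrix,
      Matrix.vecMul_vecMul]
  ext x
  rw [LinearMap.mem_ker, key, mem_rowSpace]
  constructor
  · intro h
    refine ⟨Matrix.vecMul (fun v => x (φ v)) (basisMatrix (G.incidenceMatrix τ) T φ)⁻¹,
      fun e => ?_⟩
    by_cases he : e ∈ T
    · have : e = φ (φ.symm ⟨e, he⟩) := by simp
      rw [this, ← vecMul_basisMatrix (T := T) (φ := φ), Matrix.vecMul_vecMul,
        Matrix.nonsing_inv_mul _ hunit, Matrix.vecMul_one]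
    · rw [← vecMul_restMatrix _ (⟨e, he⟩ : {e // e ∉ T})]
      exact h ⟨e, he⟩
  · rintro ⟨y, hy⟩ r
    have : (fun v => x (φ v)) = Matrix.vecMul y (basisMatrix (G.incidenceMatrix τ) T φ) :=
      funext fun v => by rw [vecMul_basisMatrix, hy]
    rw [this, Matrix.vecMul_vecMul y, Matrix.mul_nonsing_inv _ hunit, Matrix.vecMul_one,
      vecMul_restMatrix, hy]

variable [Fintype E]

/-- A row y of T⁻¹ has integer products with the columns in `T`. By `hTU` it then has integer
products with all columns, and those with the columns of R are the entries of B. -/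
theorem binetMatrix_integral (hT : G.edgeKer ℝ τ T = ⊥)
    (hTU : G.edgeKer UnitAddCircle τ T = G.edgeKer UnitAddCircle τ Finset.univ)
    (v : V) (r : {e // e ∉ T}) :
    ∃ k : ℤ, binetMatrix (G.incidenceMatrix τ) T φ v r = k := by
  have hunit := (Matrix.isUnit_iff_isUnit_det _).1 (isUnit_basisMatrix (φ := φ) hT)
  set y := Matrix.vecMul (Pi.single v 1) (basisMatrix (G.incidenceMatrix τ) T φ)⁻¹ with hy
  have hyT : y ∈ G.integralDual τ T := mem_integralDual.2 fun e he => by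
    have : e = φ (φ.symm ⟨e, he⟩) := by simp
    rw [this, ← vecMul_basisMatrix (T := T) (φ := φ), hy, Matrix.vecMul_vecMul,
      Matrix.nonsing_inv_mul _ hunit, Matrix.vecMul_one]
    by_cases h : φ.symm ⟨e, he⟩ = v
    · exact ⟨1, by simp [h]⟩
    · exact ⟨0, by simp [h]⟩
  rw [integralDual, hTU] at hyT
  obtain ⟨k, hk⟩ := mem_integralDual.1 hyT r (Finset.mem_univ _)
  refine ⟨k, ?_⟩
  rw [← hk, ← vecMul_restMatrix, hy, Matrix.vecMul_vecMul, Matrix.single_one_vecMul]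
  rfl

variable [DecidableEq E]

theorem dualMatrix_mulVec (A : Matrix V E ℝ) (x : E → ℝ) :
    (dualMatrix A T φ).mulVec (Sum.elim (fun r => x r) fun v => x (φ v)) = dualMap A T φ x := by
  rw [dualMatrix, Matrix.fromCols_mulVec]
  ext r
  simp [dualMap_apply, Matrix.neg_mulVec, Matrix.mulVec_transpose, sub_eq_add_neg, Function.comp_def]

/-- The dual map identifies ℝ^E modulo the row space with the target. It sends ℤ^E into the integer
points because B is integral, and onto them because an integer point extends by zero on `T`. -/
theorem dilateLatticePoints_eq (hT : G.edgeKer ℝ τ T = ⊥)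
    (hTU : G.edgeKer UnitAddCircle τ T = G.edgeKer UnitAddCircle τ Finset.univ)
    {t : ℕ} (ht : 0 < t) :
    dilateLatticePoints (zonotope (dualMatrix (G.incidenceMatrix τ) T φ)) t =
      (G.rowSpace τ).liftQ (dualMap (G.incidenceMatrix τ) T φ) (ker_dualMap hT).ge ''
        zonotopeClasses (integerVectors E) (G.rowSpace τ)
          (fun i => (Pi.single i 1 : E → ℝ)) Finset.univ t := by
  have ht' : (0 : ℝ) < t := by exact_mod_cast ht
  set A := G.incidenceMatrix τ
  have hint : ∀ z ∈ integerVectors E, ∀ r, ∃ k : ℤ, dualMap A T φ z r = k := by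
    intro z hz r
    choose k hk using hz
    choose b hb using fun v => binetMatrix_integral (φ := φ) hT hTU v r
    refine ⟨k r - ∑ v, k (φ v) * b v, ?_⟩
    rw [dualMap_apply]
    simp [Matrix.vecMul, dotProduct, hk, hb, A]
  have hclass : ∀ x y : E → ℝ, (G.rowSpace τ).mkQ x = (G.rowSpace τ).mkQ y ↔
      dualMap A T φ x = dualMap A T φ y := by
    intro x y
    rw [← sub_eq_zero (a := dualMap A T φ x), ← map_sub, ← LinearMap.mem_ker, ker_dualMap hT]
    exact Submodule.Quotient.eq _
  have hsum : ∀ x : E → ℝ, ∑ i, x i • (Pi.single i 1 : E → ℝ) = x := fun x => by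
    rw [sum_smul_single]
    simp
  ext p
  constructor
  · rintro ⟨⟨_, ⟨c, hc, rfl⟩, hp⟩, hpint⟩
    have hcc : ∀ i, 0 ≤ c i ∧ c i ≤ 1 := fun i => ⟨hc.1 i, hc.2 i⟩
    let x : E → ℝ := fun e =>
      if he : e ∈ T then t * c (Sum.inr (φ.symm ⟨e, he⟩)) else t * c (Sum.inl ⟨e, he⟩)
    have hx : ∀ e, 0 ≤ x e ∧ x e ≤ t := by
      intro e
      by_cases he : e ∈ T
      · simp only [x, dif_pos he]
        exact ⟨mul_nonneg ht'.le (hcc _).1, mul_le_of_le_one_right ht'.le (hcc _).2⟩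
      · simp only [x, dif_neg he]
        exact ⟨mul_nonneg ht'.le (hcc _).1, mul_le_of_le_one_right ht'.le (hcc _).2⟩
    have hxc : (Sum.elim (fun r : {e // e ∉ T} => x r) fun v => x (φ v)) = (t : ℝ) • c := by
      ext (r | v)
      · simp [x, r.2]
      · simp [x]
    have hpx : p = dualMap A T φ x := by
      rw [← dualMatrix_mulVec, hxc, Matrix.mulVec_smul]
      exact hp
    let z : E → ℝ := fun e => if he : e ∈ T then 0 else p ⟨e, he⟩
    have hz : z ∈ integerVectors E := by
      intro e
      by_cases he : e ∈ T
      · exact ⟨0, by simp [z, he]⟩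
      · simpa [z, he] using hpint ⟨e, he⟩
    have hzp : dualMap A T φ z = p := by
      ext r
      have : (fun v => z (φ v)) = 0 := by
        ext v
        simp [z]
      rw [dualMap_apply, this, Matrix.zero_vecMul]
      simp [z, r.2]
    refine ⟨(G.rowSpace τ).mkQ z, ⟨⟨z, hz, rfl⟩, x, fun i _ => hx i, ?_⟩, hzp⟩
    rw [hsum, hclass, ← hpx, hzp]
  · rintro ⟨_, ⟨⟨z, hz, rfl⟩, x, hx, hxz⟩, rfl⟩
    rw [hsum, hclass] at hxz
    change dualMap A T φ z ∈ _
    refine ⟨⟨_, ⟨(t : ℝ)⁻¹ • Sum.elim (fun r : {e // e ∉ T} => x r) fun v => x (φ v), ?_, rfl⟩, ?_⟩, hint z hz⟩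
    · have h01 : ∀ e, 0 ≤ (t : ℝ)⁻¹ * x e ∧ (t : ℝ)⁻¹ * x e ≤ 1 := fun e => by
        have := hx e (Finset.mem_univ e)
        refine ⟨mul_nonneg (inv_nonneg.2 ht'.le) this.1, ?_⟩
        rw [inv_mul_le_iff₀ ht', mul_one]
        exact this.2
      constructor
      · rintro (r | v)
        · exact (h01 _).1
        · exact (h01 _).1
      · rintro (r | v)
        · exact (h01 _).2
        · exact (h01 _).2
    · simp only [Matrix.mulVec_smul]
      rw [smul_smul, mul_inv_cancel₀ ht'.ne', one_smul, ← hxz]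
      exact (dualMatrix_mulVec A x).symm

end Binet

variable [Fintype E] [DecidableEq E]

/-- Multiplication by |K_{ℝ/ℤ}(E)| turns each relative index into the order of K_{ℝ/ℤ}(S), where S
is the complement of I. -/
theorem ncard_dilateLatticePoints (hτ : G.IsOrientation τ)
    (h0 : G.edgeKer ℝ τ Finset.univ = ⊥) {T : Finset E} (φ : V ≃ {e // e ∈ T})
    (hT : G.edgeKer ℝ τ T = ⊥)
    (hTU : G.edgeKer UnitAddCircle τ T = G.edgeKer UnitAddCircle τ Finset.univ)
    {t : ℕ} (ht : 0 < t) :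
    (dilateLatticePoints (zonotope (dualMatrix (G.incidenceMatrix τ) T φ)) t).Finite ∧
    Nat.card (G.edgeKer UnitAddCircle τ Finset.univ) *
        (dilateLatticePoints (zonotope (dualMatrix (G.incidenceMatrix τ) T φ)) t).ncard =
      ∑ S ∈ G.spanningSets, 2 ^ G.minPcLc S * t ^ (Fintype.card E - S.card) := by
  classical
  have hindex : ∀ I : Finset E,
      IndepMod (G.rowSpace τ) (fun i => (Pi.single i 1 : E → ℝ)) I →
      Nat.card (G.edgeKer UnitAddCircle τ Finset.univ) *
        latticeIndex (integerVectors E) (G.rowSpace τ) (fun i => (Pi.single i 1 : E → ℝ)) I =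
        2 ^ G.minPcLc Iᶜ := by
    intro I hI
    rw [indepMod_rowSpace_iff h0] at hI
    rw [latticeIndex_rowSpace hI, ← card_edgeKer_eq_two_pow_minPcLc hτ hI,
      ← AddSubgroup.relIndex_bot_left, ← AddSubgroup.relIndex_bot_left]
    exact AddSubgroup.relIndex_mul_relIndex _ _ _ bot_le (edgeKer_anti (Finset.subset_univ _))
  -- The indices do not vanish, as they divide a power of 2 by `hindex`.
  obtain ⟨hfin, hcard⟩ := ncard_zonotopeClasses (L := integerVectors E)
    (a := fun i => (Pi.single i 1 : E → ℝ)) (fun i => by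
      refine mem_integerVectors.2 fun e => ?_
      by_cases he : e = i
      · subst he
        exact ⟨1, by simp⟩
      · exact ⟨0, by simp [he]⟩) ht Finset.univ (G.rowSpace τ) fun I _ hI h => by
        have := hindex I hI
        rw [h, mul_zero] at this
        exact absurd this.symm (by positivity)
  rw [dilateLatticePoints_eq hT hTU ht]
  refine ⟨hfin.image _, ?_⟩
  rw [Set.ncard_image_of_injective, hcard, Finset.mul_sum, Finset.powerset_univ]
  swap
  · rw [← LinearMap.ker_eq_bot]
    exact Submodule.ker_liftQ_eq_bot _ _ _ (ker_dualMap hT).le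
  simp only [mul_ite, mul_zero]
  rw [← Finset.sum_filter]
  refine Finset.sum_nbij' compl compl ?_ ?_ ?_ ?_ ?_
  · intro I hI
    rw [Finset.mem_filter, indepMod_rowSpace_iff h0, ← isSpanning_iff hτ h0] at hI
    exact Finset.mem_filter.2 ⟨Finset.mem_univ _, hI.2⟩
  · intro S hS
    have hS := (Finset.mem_filter.1 hS).2
    rw [Finset.mem_filter, indepMod_rowSpace_iff h0, compl_compl, ← isSpanning_iff hτ h0]
    exact ⟨Finset.mem_univ _, hS⟩
  · exact fun I _ => compl_compl I
  · exact fun S _ => compl_compl S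
  · intro I hI
    rw [← mul_assoc, hindex I (Finset.mem_filter.1 hI).2, Finset.card_compl,
      Nat.sub_sub_self (Finset.card_le_univ I)]

end SignedGraph

/-! ### The Ehrhart polynomial -/

theorem mainTheorem3 {V E : Type*} [Fintype V] [DecidableEq V] [Fintype E] [DecidableEq E]
    (G : SignedGraph V E) (hconn : G.ConnectedOn Finset.univ)
    (τ : V → E → ℤˣ) (hτ : G.IsOrientation τ)
    (hrank : (G.incidenceMatrix τ).rank = Fintype.card V)
    (T : Finset E) (hT : G.IsBasis T) (hTconn : G.ConnectedOn T)
    (hThalf : G.HasHalfedge → ∃ e ∈ T, G.IsHalfedge e)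
    (φ : V ≃ {e // e ∈ T}) :
    (G.HasHalfedge →
      IsEhrhartPolynomial
        (zonotope (SignedGraph.dualMatrix (G.incidenceMatrix τ) T φ))
        (∑ S ∈ G.spanningSets,
          Polynomial.C ((2 : ℚ) ^ G.minPcLc S) * Polynomial.X ^ (Fintype.card E - S.card))) ∧
    (¬ G.HasHalfedge →
      IsEhrhartPolynomial
        (zonotope (SignedGraph.dualMatrix (G.incidenceMatrix τ) T φ))
        (∑ S ∈ G.spanningSets,
          Polynomial.C ((2 : ℚ) ^ ((G.minPcLc S : ℤ) - 1)) *
            Polynomial.X ^ (Fintype.card E - S.card))) := by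
  have h0 := SignedGraph.edgeKer_univ_eq_bot hrank
  have hT0 := ((SignedGraph.isBasis_iff hτ h0).1 hT).2
  obtain ⟨hE1, hE2⟩ := SignedGraph.card_edgeKer_of_connectedOn hτ h0 hconn
  obtain ⟨hT1, hT2⟩ := SignedGraph.card_edgeKer_of_connectedOn hτ hT0 hTconn
  simp only [Finset.mem_univ, true_and] at hE1 hE2
  have hle := SignedGraph.edgeKer_anti (G := G) (τ := τ) (X := UnitAddCircle) (Finset.subset_univ T)
  -- Both kernels have order 1 with a halfedge and order 2 without, since `T` and Σ are connected
  -- and `T` has a halfedge if Σ has one. One kernel contains the other, so they are equal.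
  have hTU : G.edgeKer UnitAddCircle τ T = G.edgeKer UnitAddCircle τ Finset.univ := by
    have hcard : Nat.card (G.edgeKer UnitAddCircle τ T) ≤
        Nat.card (G.edgeKer UnitAddCircle τ Finset.univ) ∧
        Nat.card (G.edgeKer UnitAddCircle τ T) ≠ 0 := by
      by_cases h : G.HasHalfedge
      · rw [hT1 (hThalf h), hE1 h]
        simp
      · rw [hE2 h, hT2 fun ⟨e, _, he⟩ => h ⟨e, he⟩]
        simp
    have : Finite (G.edgeKer UnitAddCircle τ T) := Nat.finite_of_card_ne_zero hcard.2
    exact (AddSubgroup.eq_of_le_of_card_ge hle hcard.1).symm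
  constructor
  · intro h t ht
    obtain ⟨hfin, hcard⟩ := SignedGraph.ncard_dilateLatticePoints hτ h0 φ hT0 hTU ht
    refine ⟨hfin, ?_⟩
    rw [hE1 h, one_mul] at hcard
    rw [hcard, Polynomial.eval_finsetSum]
    simp
  · intro h t ht
    obtain ⟨hfin, hcard⟩ := SignedGraph.ncard_dilateLatticePoints hτ h0 φ hT0 hTU ht
    refine ⟨hfin, ?_⟩
    rw [hE2 h] at hcard
    have hcard := congrArg (Nat.cast : ℕ → ℚ) hcard
    push_cast at hcard
    -- The factor 2 is the order of the kernel for `E`; it accounts for the exponent -1.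
    rw [← mul_right_inj' (two_ne_zero (α := ℚ)), hcard, Polynomial.eval_finsetSum, Finset.mul_sum]
    refine Finset.sum_congr rfl fun S _ => ?_
    rw [zpow_sub₀ two_ne_zero, zpow_natCast, zpow_one]
    simp only [Polynomial.eval_mul, Polynomial.eval_C, Polynomial.eval_pow, Polynomial.eval_X]
    field_simp
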